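/- **Theorem 1.** Let $E\subseteq[0,L]$ be a Lebesgue measurable set with $|E|=1$, where $L=3/2-\epsilon$ for some $\epsilon>0$. For $T\subset\mathbb{R}$, we say that $E+T=\mathbb{R}$ is a tiling if, up to sets of measure $0$, the translates $E+t$ ($t\in T$) are mutually disjoint and their union is $\mathbb{R}$; $E$ tiles $\mathbb{R}$ by translations if this holds for some discrete $T$. A discrete set $\Lambda\subset\mathbb{R}$ is a spectrum of $E$ if $\{e^{2\pi i\lambda x}:\lambda\in\Lambda\}$ is an orthogonal basis of $L^2(E)$; $E$ is spectral if it has a spectrum. Let $\Lambda\subset\mathbb{R}$ be any discrete set with $0\in\Lambda$. Then (a) if $E+\Lambda=\mathbb{R}$ is a tiling, then $\Lambda=\mathbb{Z}$; (b) if $\Lambda$ is a spectrum of $E$, then $\Lambda=\mathbb{Z}$. Consequently, Fuglede's conjecture holds for $E$: the set $E$ tiles $\mathbb{R}$ by translations if and only if it is spectral. -/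

import Mathlib

open MeasureTheory

/-- `E + T = ℝ` is a tiling: up to sets of Lebesgue measure zero, the translates `E + t`, `t ∈ T`,
are mutually disjoint and cover the real line. -/
def IsTiling (E T : Set ℝ) : Prop :=
  T.Pairwise (fun s t => AEDisjoint volume ((fun x => x + s) '' E) ((fun x => x + t) '' E)) ∧
    volume (⋃ t ∈ T, (fun x => x + t) '' E)ᶜ = 0

/-- `E` tiles the real line by translations: it has a discrete translation set. -/
def TilesByTranslations (E : Set ℝ) : Prop :=
  ∃ T : Set ℝ, IsDiscrete T ∧ IsTiling E T

/-- The exponentials `x ↦ exp (2 π i l x)`, `l ∈ Λ`, form an orthogonal basis of `L²(E)`: they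
belong to `L²(E)` (their classes are the `e l`), are pairwise orthogonal, and their linear span is
dense. They are nonzero as soon as `E` has positive measure. -/
def IsSpectrum (E Λ : Set ℝ) : Prop :=
  ∃ e : Λ → Lp ℂ 2 (volume.restrict E),
    (∀ l : Λ, e l =ᵐ[volume.restrict E]
      fun x : ℝ => Complex.exp (2 * Real.pi * Complex.I * ((l : ℝ) : ℂ) * (x : ℂ))) ∧
    Pairwise (fun l m : Λ => inner ℂ (e l) (e m) = 0) ∧
    (Submodule.span ℂ (Set.range e)).topologicalClosure = ⊤

/-- `E` is spectral: it has a discrete spectrum. -/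
def IsSpectral (E : Set ℝ) : Prop :=
  ∃ Λ : Set ℝ, IsDiscrete Λ ∧ IsSpectrum E Λ

/-!
The proof rests on one geometric fact: a set `E` of measure one in an interval of length less than
`3 / 2` overlaps its translate by `x` in positive measure whenever `|x| < 1`
(`one_le_of_measure_overlap_eq_zero`).

*Tilings.* The overlap fact separates the elements of a tiling set `Λ` by at least one. Hence only
two tiles meet the interval between two consecutive elements, and measuring that interval relates
consecutive gaps through the tail function `y ↦ |E ∩ (y, ∞)|` (`IsTiling.gap_eq`). A gap larger than
one would make all later gaps strictly larger, while their excesses over one have a sum bounded by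
the measure of the tail; so all gaps equal one (`IsTiling.next_eq_add_one`).

*Spectra.* Parseval's identity holds for pairs of functions supported in one translate of `E`. It
extends to pairs `h`, `k` supported in short intervals around `s` and `s + d` with `|d| < 1`
(`IsSpectrum.exists_isParsevalPair`): by the overlap fact and the Lebesgue density theorem some
translate of `E` contains most of the mass of `h` and of `k` at once, so that any bound for the
defect in Parseval's identity can be halved, and the defect is zero. That a bound exists is a local
Bessel inequality, obtained by the same self-improvement (`IsSpectrum.exists_bessel`). Compactness
and additivity give Parseval's identity on `(0, r]` for all `r < 1`, applied to the exponential
with a frequency `m ∈ Λ`. The term of `m` alone is `r ^ 2`, out of a total of `r`; as `r → 1` the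
exponentials with frequencies `l ≠ m` in `Λ` become orthogonal to it on `(0, 1]`, which means that
`l - m` is an integer (`IsSpectrum.exists_int_sub`).

*Equivalence.* Both tilings and spectra force `E` and `E - 1` to overlap in measure zero. Then `E`
folds modulo one onto a period, so that the integers are at the same time a tiling set
(`isTiling_intCast`) and, by Fourier series, a spectrum (`isSpectrum_intCast`).
-/

open Set
open scoped ComplexConjugate ENNReal

/-! ### Overlaps of translates -/

theorem measureReal_preimage_add_right (x : ℝ) (A : Set ℝ) :
    volume.real ((fun y => y + x) ⁻¹' A) = volume.real A := by
  simp only [Measure.real, measure_preimage_add_right]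

theorem measure_ne_top_of_subset_Ioc {A : Set ℝ} {a b : ℝ} (h : A ⊆ Ioc a b) :
    volume A ≠ ⊤ :=
  ((measure_mono h).trans_lt measure_Ioc_lt_top).ne

/-- A set of measure one inside an interval of length less than `3 / 2` meets each of its translates
by less than one in positive measure. -/
theorem one_le_of_measure_overlap_eq_zero {E : Set ℝ} {L x : ℝ} (hL : L < 3 / 2)
    (hE : MeasurableSet E) (hEL : E ⊆ Ioc 0 L) (hvol : volume E = 1) (hx : 0 ≤ x)
    (h : volume (E ∩ (fun y => y + x) ⁻¹' E) = 0) : 1 ≤ x := by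
  by_contra! hx1
  have hr : volume.real E = 1 := by simp [Measure.real, hvol]
  have hm : Measurable (fun y : ℝ => y + x) := measurable_add_const x
  have hL1 : 1 ≤ L := by
    have h1 := measureReal_mono hEL (μ := volume) measure_Ioc_lt_top.ne
    rw [hr, Real.volume_real_Ioc, sub_zero] at h1
    rcases le_max_iff.1 h1 with h2 | h2
    · exact h2
    · norm_num at h2
  rcases le_or_gt x (L - 1) with hxL | hxL
  · -- both copies fit into an interval of length less than two
    have hsub : E ∪ (fun y => y + x) ⁻¹' E ⊆ Ioc (-x) L := by
      rintro y (hy | hy)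
      · have := hEL hy
        exact ⟨by linarith [this.1], this.2⟩
      · have := hEL hy
        simp only [mem_Ioc] at this ⊢
        constructor <;> linarith [this.1, this.2]
    have h1 := measureReal_mono hsub (μ := volume) measure_Ioc_lt_top.ne
    rw [measureReal_union₀ (hm hE).nullMeasurableSet h (by simp [hvol])
      (by simp [measure_preimage_add_right, hvol]), measureReal_preimage_add_right, hr,
      Real.volume_real_Ioc] at h1
    rcases le_max_iff.1 h1 with h2 | h2 <;> linarith
  · -- the part of `E` beyond `x`, shifted back by `x`, avoids `E` inside `(0, L - x]`
    set A := E ∩ Ioc 0 (L - x)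
    set B := (fun y => y + x) ⁻¹' (E ∩ Ioc x L)
    have hAB : A ∪ B ⊆ Ioc 0 (L - x) := by
      rintro y (hy | hy)
      · exact hy.2
      · have h2 := hy.2
        simp only [mem_Ioc] at h2 ⊢
        constructor <;> linarith [h2.1, h2.2]
    have h1 := measureReal_mono hAB (μ := volume) measure_Ioc_lt_top.ne
    have hd : AEDisjoint volume A B :=
      measure_mono_null (inter_subset_inter inter_subset_left
        (preimage_mono inter_subset_left)) h
    have hBm : MeasurableSet B := hm (hE.inter measurableSet_Ioc)
    rw [measureReal_union₀ hBm.nullMeasurableSet hd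
      (measure_ne_top_of_subset_Ioc (subset_union_left.trans hAB))
      (measure_ne_top_of_subset_Ioc (subset_union_right.trans hAB)),
      measureReal_preimage_add_right, Real.volume_real_Ioc, sub_zero,
      max_eq_left (by linarith)] at h1
    have hcov : E ⊆ (A ∪ (E ∩ Ioc x L)) ∪ Ioc (L - x) x := by
      intro y hy
      have := hEL hy
      by_cases hy1 : y ≤ L - x
      · exact Or.inl (Or.inl ⟨hy, this.1, hy1⟩)
      · by_cases hy2 : y ≤ x
        · exact Or.inr ⟨not_le.1 hy1, hy2⟩
        · exact Or.inl (Or.inr ⟨hy, not_le.1 hy2, this.2⟩)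
    have hfin : volume ((A ∪ (E ∩ Ioc x L)) ∪ Ioc (L - x) x) ≠ ⊤ := by
      refine (measure_union_lt_top (measure_union_lt_top ?_ ?_) measure_Ioc_lt_top).ne
      · exact (measure_mono inter_subset_right).trans_lt measure_Ioc_lt_top
      · exact (measure_mono inter_subset_right).trans_lt measure_Ioc_lt_top
    have h2 := measureReal_mono hcov (μ := volume) hfin
    have h3 := measureReal_union_le (μ := volume) (A ∪ (E ∩ Ioc x L)) (Ioc (L - x) x)
    have h4 := measureReal_union_le (μ := volume) A (E ∩ Ioc x L)
    rw [Real.volume_real_Ioc] at h3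
    have h5 : max (x - (L - x)) 0 < 1 - (L - x) := max_lt (by linarith) (by linarith)
    linarith

/-! ### Gaps of a tiling set -/

theorem mem_image_add_right_iff {E : Set ℝ} {s x : ℝ} :
    x ∈ (fun y => y + s) '' E ↔ x - s ∈ E := by
  constructor
  · rintro ⟨y, hy, rfl⟩; simpa using hy
  · exact fun h => ⟨x - s, h, by simp⟩

theorem image_add_right_eq_preimage (E : Set ℝ) (s : ℝ) :
    (fun y => y + s) '' E = (fun y => y + -s) ⁻¹' E := by
  ext x; rw [mem_image_add_right_iff, mem_preimage, sub_eq_add_neg]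

theorem measurableSet_image_add_right {E : Set ℝ} (hE : MeasurableSet E) (s : ℝ) :
    MeasurableSet ((fun y => y + s) '' E) := by
  rw [image_add_right_eq_preimage]; exact measurable_add_const (-s) hE

theorem measure_image_add_right_inter (E : Set ℝ) (s t : ℝ) :
    volume (((fun y => y + s) '' E) ∩ ((fun y => y + t) '' E)) =
      volume (E ∩ (fun y => y + (s - t)) ⁻¹' E) := by
  rw [← measure_preimage_add_right volume s]
  congr 1
  ext x
  simp only [mem_preimage, mem_inter_iff, mem_image_add_right_iff, add_sub_cancel_right,
    add_sub_assoc]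

section Tiling

variable {E Λ : Set ℝ} {L : ℝ}

theorem IsTiling.one_le_sub (hL : L < 3 / 2) (hE : MeasurableSet E) (hEL : E ⊆ Ioc 0 L)
    (hvol : volume E = 1) (hT : IsTiling E Λ) {s t : ℝ} (hs : s ∈ Λ) (ht : t ∈ Λ) (hst : s < t) :
    1 ≤ t - s := by
  refine one_le_of_measure_overlap_eq_zero hL hE hEL hvol (by linarith) ?_
  rw [← measure_image_add_right_inter]
  exact hT.1 ht hs hst.ne'

/-- Every interval of positive length meets a tile. -/
theorem IsTiling.exists_mem_Ioo (hT : IsTiling E Λ) {a b : ℝ} (hab : a < b) :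
    ∃ x ∈ Ioo a b, ∃ t ∈ Λ, x - t ∈ E := by
  by_contra! h
  have h1 : Ioo a b ⊆ (⋃ t ∈ Λ, (fun x => x + t) '' E)ᶜ := by
    intro x hx hx'
    simp only [mem_iUnion, mem_image_add_right_iff, exists_prop] at hx'
    obtain ⟨t, ht, hxt⟩ := hx'
    exact h x hx t ht hxt
  have h2 := measure_mono_null h1 hT.2
  rw [Real.volume_Ioo, ENNReal.ofReal_eq_zero] at h2
  linarith

/-- Each element of a tiling set has a successor. -/
theorem IsTiling.exists_next (hL : L < 3 / 2) (hE : MeasurableSet E) (hEL : E ⊆ Ioc 0 L)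
    (hvol : volume E = 1) (hT : IsTiling E Λ) (l : ℝ) :
    ∃ n ∈ Λ, l < n ∧ ∀ t ∈ Λ, l < t → n ≤ t := by
  obtain ⟨x, hx, t, ht, hxt⟩ := hT.exists_mem_Ioo (show l + L < l + L + 1 by linarith)
  have h1 := hEL hxt
  have hne : (Λ ∩ Ioi l).Nonempty := ⟨t, ht, by simp only [mem_Ioi]; linarith [h1.2, hx.1]⟩
  have hbdd : BddBelow (Λ ∩ Ioi l) := ⟨l, fun y hy => le_of_lt hy.2⟩
  obtain ⟨n, hn, hlt⟩ := exists_lt_of_csInf_lt hne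
    (show sInf (Λ ∩ Ioi l) < sInf (Λ ∩ Ioi l) + 1 by linarith)
  refine ⟨n, hn.1, hn.2, fun s hs hls => ?_⟩
  by_contra! hsn
  have h2 := hT.one_le_sub hL hE hEL hvol hs hn.1 hsn
  have h3 := csInf_le hbdd (show s ∈ Λ ∩ Ioi l from ⟨hs, hls⟩)
  linarith

/-- Each element of a tiling set has a predecessor. -/
theorem IsTiling.exists_prev (hL : L < 3 / 2) (hE : MeasurableSet E) (hEL : E ⊆ Ioc 0 L)
    (hvol : volume E = 1) (hT : IsTiling E Λ) (l : ℝ) :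
    ∃ n ∈ Λ, n < l ∧ ∀ t ∈ Λ, t < l → t ≤ n := by
  obtain ⟨x, hx, t, ht, hxt⟩ := hT.exists_mem_Ioo (show l - 1 < l by linarith)
  have h1 := hEL hxt
  have hne : (Λ ∩ Iio l).Nonempty := ⟨t, ht, by simp only [mem_Iio]; linarith [h1.1, hx.2]⟩
  have hbdd : BddAbove (Λ ∩ Iio l) := ⟨l, fun y hy => le_of_lt hy.2⟩
  obtain ⟨n, hn, hlt⟩ := exists_lt_of_lt_csSup hne
    (show sSup (Λ ∩ Iio l) - 1 < sSup (Λ ∩ Iio l) by linarith)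
  refine ⟨n, hn.1, hn.2, fun s hs hls => ?_⟩
  by_contra! hsn
  have h2 := hT.one_le_sub hL hE hEL hvol hn.1 hs hsn
  have h3 := le_csSup hbdd (show s ∈ Λ ∩ Iio l from ⟨hs, hls⟩)
  linarith

/-- Between consecutive translations `l < n` only the tile at `l` and the tail of the tile at the
predecessor `m` of `l` are present; the measure of `(l, n]` is the sum of their contributions. -/
theorem IsTiling.gap_eq (hL : L < 3 / 2) (hE : MeasurableSet E) (hEL : E ⊆ Ioc 0 L)
    (hvol : volume E = 1) (hT : IsTiling E Λ) {m l n : ℝ} (hm : m ∈ Λ) (hl : l ∈ Λ) (hn : n ∈ Λ)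
    (hml : m < l) (hln : l < n) (hm' : ∀ t ∈ Λ, t < l → t ≤ m) (hn' : ∀ t ∈ Λ, l < t → n ≤ t) :
    n - l = 1 - volume.real (E ∩ Ioi (n - l)) + volume.real (E ∩ Ioi (l - m)) := by
  have h1 := hT.one_le_sub hL hE hEL hvol hm hl hml
  have h2 := hT.one_le_sub hL hE hEL hvol hl hn hln
  have hr : volume.real E = 1 := by simp [Measure.real, hvol]
  set A := ((fun y => y + l) '' E) ∩ Ioc l n
  set B := ((fun y => y + m) '' E) ∩ Ioc l n
  have hAm : MeasurableSet A := (measurableSet_image_add_right hE l).inter measurableSet_Ioc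
  have hBm : MeasurableSet B := (measurableSet_image_add_right hE m).inter measurableSet_Ioc
  have hd : AEDisjoint volume A B :=
    measure_mono_null (inter_subset_inter inter_subset_left inter_subset_left)
      (hT.1 hl hm hml.ne')
  have hae : (Ioc l n : Set ℝ) =ᵐ[volume] (A ∪ B : Set ℝ) := by
    have hc : ∀ᵐ x ∂volume, x ∈ ⋃ t ∈ Λ, (fun x => x + t) '' E := hT.2
    refine Filter.eventuallyEq_set.2 ?_
    filter_upwards [hc] with x hx
    constructor
    · intro hxI
      simp only [mem_iUnion, exists_prop] at hx
      obtain ⟨t, ht, hxt⟩ := hx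
      have h3 := hEL (mem_image_add_right_iff.1 hxt)
      rcases lt_trichotomy t l with h4 | h4 | h4
      · rcases (hm' t ht h4).lt_or_eq with h5 | h5
        · have h6 := hT.one_le_sub hL hE hEL hvol ht hm h5
          linarith [h3.2, hxI.1]
        · subst h5; exact Or.inr ⟨hxt, hxI⟩
      · subst h4; exact Or.inl ⟨hxt, hxI⟩
      · have h5 := hn' t ht h4
        linarith [h3.1, hxI.2]
    · rintro (h | h) <;> exact h.2
  have hA : volume.real A = 1 - volume.real (E ∩ Ioi (n - l)) := by
    have h3 := measureReal_inter_add_sdiff (μ := volume) (s := E) (t := Ioi (n - l))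
      measurableSet_Ioi (by simp [hvol])
    have h4 : volume.real A = volume.real (E \ Ioi (n - l)) := by
      rw [← measureReal_preimage_add_right l A]
      congr 1
      ext x
      simp only [A, mem_preimage, mem_inter_iff, mem_image_add_right_iff, add_sub_cancel_right,
        mem_Ioc, mem_sdiff, mem_Ioi, not_lt]
      constructor
      · rintro ⟨ha, hb, hc⟩; exact ⟨ha, by linarith⟩
      · rintro ⟨ha, hb⟩; exact ⟨ha, by linarith [(hEL ha).1], by linarith⟩
    linarith
  have hB : volume.real B = volume.real (E ∩ Ioi (l - m)) := by
    rw [← measureReal_preimage_add_right m B]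
    congr 1
    ext x
    simp only [B, mem_preimage, mem_inter_iff, mem_image_add_right_iff, add_sub_cancel_right,
      mem_Ioc, mem_Ioi]
    constructor
    · rintro ⟨ha, hb, hc⟩; exact ⟨ha, by linarith⟩
    · rintro ⟨ha, hb⟩; exact ⟨ha, by linarith, by linarith [(hEL ha).2]⟩
  have h3 := measureReal_congr hae
  rw [measureReal_union₀ hBm.nullMeasurableSet hd
      (measure_ne_top_of_subset_Ioc inter_subset_right)
      (measure_ne_top_of_subset_Ioc inter_subset_right), hA, hB, Real.volume_real_Ioc,
      max_eq_left (by linarith)] at h3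
  exact h3

/-- Consecutive elements of a tiling set differ by exactly one. A gap larger than one forces the
next gap to be larger still, while the excesses of all later gaps are paid for out of the measure of
the tail of `E`, of which there is at most one. -/
theorem IsTiling.next_eq_add_one (hL : L < 3 / 2) (hE : MeasurableSet E) (hEL : E ⊆ Ioc 0 L)
    (hvol : volume E = 1) (hT : IsTiling E Λ) {l n : ℝ} (hl : l ∈ Λ) (hn : n ∈ Λ)
    (hln : l < n) (hn' : ∀ t ∈ Λ, l < t → n ≤ t) : n = l + 1 := by
  set F : ℝ → ℝ := fun y => volume.real (E ∩ Ioi y) with hF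
  have hfin : ∀ y, volume (E ∩ Ioi y) ≠ ⊤ := fun y =>
    ((measure_mono inter_subset_left).trans_lt (by simp [hvol])).ne
  have hFanti : Antitone F := fun a b hab =>
    measureReal_mono (inter_subset_inter_right _ (Ioi_subset_Ioi hab)) (hfin a)
  by_contra hne
  have hgap := hT.one_le_sub hL hE hEL hvol hl hn hln
  have hd : 0 < n - l - 1 := lt_of_le_of_ne (by linarith) fun h => hne (by linarith)
  set d := n - l - 1
  have key : ∀ k : ℕ, ∃ a ∈ Λ, ∃ b ∈ Λ, a < b ∧ (∀ t ∈ Λ, a < t → b ≤ t) ∧ 1 + d ≤ b - a ∧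
      F (b - a) ≤ 1 - k * d := by
    intro k
    induction k with
    | zero =>
      refine ⟨l, hl, n, hn, hln, hn', by simp [d], ?_⟩
      have : F (n - l) ≤ volume.real E := measureReal_mono inter_subset_left (by simp [hvol])
      simpa [Measure.real, hvol] using this
    | succ k ih =>
      obtain ⟨a, ha, b, hb, hab, hb', hbd, hFk⟩ := ih
      obtain ⟨p, hp, hpa, hp'⟩ := hT.exists_prev hL hE hEL hvol a
      obtain ⟨c, hc, hbc, hc'⟩ := hT.exists_next hL hE hEL hvol b
      have e1 : b - a = 1 - F (b - a) + F (a - p) :=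
        hT.gap_eq hL hE hEL hvol hp ha hb hpa hab hp' hb'
      have e2 : c - b = 1 - F (c - b) + F (b - a) :=
        hT.gap_eq hL hE hEL hvol ha hb hc hab hbc
          (fun t ht htb => not_lt.1 fun h => absurd (hb' t ht h) (not_le.2 htb)) hc'
      have g1 := hT.one_le_sub hL hE hEL hvol hp ha hpa
      have g2 := hT.one_le_sub hL hE hEL hvol hb hc hbc
      have f1 : F (a - p) ≤ F 1 := hFanti g1
      have g3 : c - b ≠ 1 := by
        intro h
        rw [h] at e2
        linarith
      have g4 : b - a < c - b := by
        by_contra! h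
        have := hFanti h
        exact g3 (by linarith)
      refine ⟨b, hb, c, hc, hbc, hc', by linarith, ?_⟩
      push_cast
      linarith
  obtain ⟨k, hk⟩ := exists_nat_gt (1 / d)
  obtain ⟨a, -, b, -, -, -, -, h⟩ := key k
  rw [div_lt_iff₀ hd] at hk
  have : 0 ≤ F (b - a) := measureReal_nonneg
  linarith

theorem IsTiling.add_one_mem (hL : L < 3 / 2) (hE : MeasurableSet E) (hEL : E ⊆ Ioc 0 L)
    (hvol : volume E = 1) (hT : IsTiling E Λ) {l : ℝ} (hl : l ∈ Λ) : l + 1 ∈ Λ := by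
  obtain ⟨n, hn, hln, hn'⟩ := hT.exists_next hL hE hEL hvol l
  rwa [← hT.next_eq_add_one hL hE hEL hvol hl hn hln hn']

theorem IsTiling.sub_one_mem (hL : L < 3 / 2) (hE : MeasurableSet E) (hEL : E ⊆ Ioc 0 L)
    (hvol : volume E = 1) (hT : IsTiling E Λ) {l : ℝ} (hl : l ∈ Λ) : l - 1 ∈ Λ := by
  obtain ⟨n, hn, hnl, hn'⟩ := hT.exists_prev hL hE hEL hvol l
  have := hT.next_eq_add_one hL hE hEL hvol hn hl hnl
    (fun t ht htn => not_lt.1 fun h => absurd (hn' t ht h) (not_le.2 htn))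
  rwa [show l - 1 = n by linarith]

theorem IsTiling.eq_range_intCast (hL : L < 3 / 2) (hE : MeasurableSet E) (hEL : E ⊆ Ioc 0 L)
    (hvol : volume E = 1) (hT : IsTiling E Λ) (h0 : (0 : ℝ) ∈ Λ) :
    Λ = range ((↑) : ℤ → ℝ) := by
  have hZ : ∀ k : ℤ, (k : ℝ) ∈ Λ := by
    intro k
    induction k with
    | zero => simpa using h0
    | succ i ih => push_cast; exact hT.add_one_mem hL hE hEL hvol (by exact_mod_cast ih)
    | pred i ih => push_cast at ih ⊢; exact hT.sub_one_mem hL hE hEL hvol ih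
  refine Subset.antisymm (fun t ht => ?_) (range_subset_iff.2 hZ)
  rcases (Int.floor_le t).lt_or_eq with h | h
  · have := hT.one_le_sub hL hE hEL hvol (hZ ⌊t⌋) ht h
    linarith [Int.lt_floor_add_one t]
  · exact ⟨_, h⟩

/-- A set which tiles by translations overlaps its translate by one in measure zero. -/
theorem IsTiling.measure_overlap_one (hL : L < 3 / 2) (hE : MeasurableSet E) (hEL : E ⊆ Ioc 0 L)
    (hvol : volume E = 1) (hT : IsTiling E Λ) : volume (E ∩ (fun y => y + 1) ⁻¹' E) = 0 := by
  obtain ⟨l, hl, -⟩ := hT.exists_next hL hE hEL hvol 0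
  have h1 := measure_image_add_right_inter E (l + 1) l
  rw [hT.1 (hT.add_one_mem hL hE hEL hvol hl) hl (by simp), add_sub_cancel_left] at h1
  exact h1.symm

end Tiling

/-! ### Folding a set modulo one -/

section Fold

variable {E : Set ℝ} {L : ℝ}

/-- The two pieces `E ∩ (0, 1]` and `E ∩ (1, 2] - 1` of a set of measure one make up `(0, 1]` if
they overlap in measure zero. -/
theorem fold_ae_eq (hL : L < 3 / 2) (hE : MeasurableSet E) (hEL : E ⊆ Ioc 0 L)
    (hvol : volume E = 1) (h1 : volume (E ∩ (fun y => y + 1) ⁻¹' E) = 0) :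
    AEDisjoint volume (E ∩ Ioc 0 1) ((fun y => y + 1) ⁻¹' (E ∩ Ioc 1 2)) ∧
      ((E ∩ Ioc 0 1 ∪ (fun y => y + 1) ⁻¹' (E ∩ Ioc 1 2) : Set ℝ) =ᵐ[volume] Ioc (0 : ℝ) 1) := by
  have hm : Measurable (fun y : ℝ => y + 1) := measurable_add_const 1
  have hd : AEDisjoint volume (E ∩ Ioc 0 1) ((fun y => y + 1) ⁻¹' (E ∩ Ioc 1 2)) :=
    measure_mono_null (inter_subset_inter inter_subset_left (preimage_mono inter_subset_left)) h1
  have hB : MeasurableSet ((fun y => y + 1) ⁻¹' (E ∩ Ioc (1 : ℝ) 2)) :=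
    hm (hE.inter measurableSet_Ioc)
  refine ⟨hd, ae_eq_of_subset_of_measure_ge ?_ ?_
    ((hE.inter measurableSet_Ioc).union hB).nullMeasurableSet measure_Ioc_lt_top.ne⟩
  · rintro y (hy | hy)
    · exact hy.2
    · have := hy.2
      simp only [mem_Ioc] at this ⊢
      constructor <;> linarith [this.1, this.2]
  · rw [measure_union₀ hB.nullMeasurableSet hd, measure_preimage_add_right,
      ← measure_union (Disjoint.mono inter_subset_right inter_subset_right
        (Ioc_disjoint_Ioc_of_le le_rfl)) (hE.inter measurableSet_Ioc),
      ← inter_union_distrib_left, Ioc_union_Ioc_eq_Ioc (by norm_num) (by norm_num),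
      inter_eq_left.2 (hEL.trans (Ioc_subset_Ioc_right (by linarith))), hvol]
    simp

theorem isTiling_intCast (hL : L < 3 / 2) (hE : MeasurableSet E) (hEL : E ⊆ Ioc 0 L)
    (hvol : volume E = 1) (h1 : volume (E ∩ (fun y => y + 1) ⁻¹' E) = 0) :
    IsTiling E (range ((↑) : ℤ → ℝ)) := by
  refine ⟨?_, ?_⟩
  · have key : ∀ m n : ℤ, m < n →
        AEDisjoint volume ((fun x => x + (n : ℝ)) '' E) ((fun x => x + (m : ℝ)) '' E) := by
      intro m n hmn
      refine (measure_image_add_right_inter E n m).trans ?_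
      rcases (show m + 1 ≤ n by lia).lt_or_eq with h | h
      · convert measure_empty (μ := (volume : Measure ℝ))
        refine eq_empty_of_forall_notMem fun x hx => ?_
        have ha := hEL hx.1
        have hb := hEL hx.2
        have : (m : ℝ) + 1 + 1 ≤ n := by exact_mod_cast h
        simp only [mem_Ioc] at ha hb
        linarith [ha.1, hb.2]
      · rw [← h]; push_cast; rwa [add_sub_cancel_left]
    rintro _ ⟨m, rfl⟩ _ ⟨n, rfl⟩ hmn
    rcases lt_trichotomy m n with h | h | h
    · exact (key m n h).symm
    · exact absurd (by rw [h]) hmn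
    · exact key n m h
  · have hnull : volume (Ioc (0 : ℝ) 1 \ (E ∩ Ioc 0 1 ∪ (fun y => y + 1) ⁻¹' (E ∩ Ioc 1 2))) = 0 :=
      ae_le_set.1 (fold_ae_eq hL hE hEL hvol h1).2.symm.le
    refine measure_mono_null (t := ⋃ n : ℤ, (fun x => x + (n : ℝ)) ⁻¹'
      (Ioc (0 : ℝ) 1 \ (E ∩ Ioc 0 1 ∪ (fun y => y + 1) ⁻¹' (E ∩ Ioc 1 2)))) ?_ ?_
    · intro x hx
      obtain ⟨n, hn, -⟩ := existsUnique_add_zsmul_mem_Ioc (zero_lt_one' ℝ) x 0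
      simp only [zsmul_eq_mul, mul_one, zero_add] at hn
      refine mem_iUnion.2 ⟨n, hn, fun h => hx ?_⟩
      simp only [mem_iUnion, mem_image_add_right_iff, exists_prop]
      rcases h with h | h
      · exact ⟨((-n : ℤ) : ℝ), ⟨_, rfl⟩, by push_cast; rw [sub_neg_eq_add]; exact h.1⟩
      · exact ⟨((-n - 1 : ℤ) : ℝ), ⟨_, rfl⟩, by
          push_cast; rw [show x - (-n - 1) = x + n + 1 by ring]; exact h.1⟩
    · refine measure_iUnion_null fun n => ?_
      rw [measure_preimage_add_right, hnull]

theorem setIntegral_fold (hL : L < 3 / 2) (hE : MeasurableSet E) (hEL : E ⊆ Ioc 0 L)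
    {φ : ℝ → ℂ} (hφ : IntegrableOn φ E) :
    ∫ x in E, φ x = (∫ x in E ∩ Ioc 0 1, φ x) +
      ∫ x in (fun y => y + 1) ⁻¹' (E ∩ Ioc 1 2), φ (x + 1) := by
  have hs : E = E ∩ Ioc 0 1 ∪ E ∩ Ioc 1 2 := by
    rw [← inter_union_distrib_left, Ioc_union_Ioc_eq_Ioc (by norm_num) (by norm_num),
      inter_eq_left.2 (hEL.trans (Ioc_subset_Ioc_right (by linarith)))]
  conv_lhs => rw [hs]
  rw [setIntegral_union (Disjoint.mono inter_subset_right inter_subset_right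
        (Ioc_disjoint_Ioc_of_le le_rfl)) (hE.inter measurableSet_Ioc)
        (hφ.mono_set inter_subset_left) (hφ.mono_set inter_subset_left)]
  congr 1
  exact ((measurePreserving_add_right volume (1 : ℝ)).setIntegral_preimage_emb
    (measurableEmbedding_addRight 1) φ (E ∩ Ioc 1 2)).symm

/-- Integrals of periodic functions over `E` are integrals over a period. -/
theorem setIntegral_of_periodic (hL : L < 3 / 2) (hE : MeasurableSet E) (hEL : E ⊆ Ioc 0 L)
    (hvol : volume E = 1) (h1 : volume (E ∩ (fun y => y + 1) ⁻¹' E) = 0)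
    {φ : ℝ → ℂ} (hφ : Continuous φ) (hper : ∀ x, φ (x + 1) = φ x) :
    ∫ x in E, φ x = ∫ x in (0 : ℝ)..1, φ x := by
  have hi : ∀ a b : ℝ, IntegrableOn φ (Ioc a b) := fun a b =>
    (hφ.integrableOn_Icc (a := a) (b := b)).mono_set Ioc_subset_Icc_self
  obtain ⟨hd, hae⟩ := fold_ae_eq hL hE hEL hvol h1
  have hi' := (hi 0 1).congr_set_ae hae
  have hB : MeasurableSet ((fun y => y + 1) ⁻¹' (E ∩ Ioc (1 : ℝ) 2)) :=
    measurable_add_const 1 (hE.inter measurableSet_Ioc)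
  rw [setIntegral_fold hL hE hEL ((hi 0 L).mono_set hEL),
    intervalIntegral.integral_of_le zero_le_one, ← setIntegral_congr_set hae,
    setIntegral_union₀ hd hB.nullMeasurableSet (hi'.mono_set subset_union_left)
      (hi'.mono_set subset_union_right)]
  simp only [hper]

end Fold

/-! ### Exponentials and spectra -/

/-- The character `x ↦ exp (2 π i l x)` of the real line with frequency `l`. -/
noncomputable def expChar (l x : ℝ) : ℂ := Complex.exp (2 * Real.pi * Complex.I * (l : ℂ) * (x : ℂ))

theorem continuous_expChar (l : ℝ) : Continuous (expChar l) := by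
  unfold expChar; fun_prop

theorem norm_expChar (l x : ℝ) : ‖expChar l x‖ = 1 := by
  rw [expChar, show 2 * (Real.pi : ℂ) * Complex.I * l * x = ((2 * Real.pi * l * x : ℝ) : ℂ) *
    Complex.I by push_cast; ring, Complex.norm_exp_ofReal_mul_I]

theorem expChar_mul (l m x : ℝ) : expChar l x * expChar m x = expChar (l + m) x := by
  rw [expChar, expChar, expChar, ← Complex.exp_add]; congr 1; push_cast; ring

theorem expChar_add (l x y : ℝ) : expChar l (x + y) = expChar l x * expChar l y := by
  rw [expChar, expChar, expChar, ← Complex.exp_add]; congr 1; push_cast; ring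

theorem expChar_zero (x : ℝ) : expChar 0 x = 1 := by simp [expChar]

theorem conj_expChar (l x : ℝ) : conj (expChar l x) = expChar (-l) x := by
  rw [expChar, expChar, ← Complex.exp_conj]
  simp [map_ofNat (starRingEnd ℂ) 2]

theorem expChar_eq_one_iff (l x : ℝ) : expChar l x = 1 ↔ ∃ n : ℤ, l * x = n := by
  rw [expChar, Complex.exp_eq_one_iff]
  refine exists_congr fun n => ?_
  rw [show 2 * (Real.pi : ℂ) * Complex.I * l * x = ((l * x : ℝ) : ℂ) * (2 * Real.pi * Complex.I) by
    push_cast; ring, mul_left_inj' Complex.two_pi_I_ne_zero]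
  norm_cast

theorem expChar_intCast_add_one (n : ℤ) (x : ℝ) : expChar n (x + 1) = expChar n x := by
  rw [expChar_add, (expChar_eq_one_iff n 1).2 ⟨n, by simp⟩, mul_one]

theorem intervalIntegral_expChar {l : ℝ} (hl : l ≠ 0) (r : ℝ) :
    ∫ x in (0 : ℝ)..r, expChar l x = (expChar l r - 1) / (2 * Real.pi * Complex.I * l) := by
  have hc : 2 * (Real.pi : ℂ) * Complex.I * l ≠ 0 :=
    mul_ne_zero Complex.two_pi_I_ne_zero (by exact_mod_cast hl)
  simp only [expChar]
  rw [integral_exp_mul_complex hc]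
  simp

theorem MeasureTheory.MemLp.mul_expChar {g : ℝ → ℂ} {μ : Measure ℝ} (hg : MemLp g 2 μ) (l : ℝ) :
    MemLp (fun x => g x * expChar l x) 2 μ := by
  refine hg.of_le (hg.1.mul (continuous_expChar l).aestronglyMeasurable) ?_
  filter_upwards with x
  simp [norm_expChar]

theorem memLp_expChar {E : Set ℝ} (hE : volume E ≠ ⊤) (l : ℝ) :
    MemLp (expChar l) 2 (volume.restrict E) := by
  have : IsFiniteMeasure (volume.restrict E) := ⟨by simpa using hE.lt_top⟩
  refine MemLp.of_bound (continuous_expChar l).aestronglyMeasurable 1 ?_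
  filter_upwards with x
  rw [norm_expChar]

section Spectrum

variable {E Λ : Set ℝ}

/-- Parseval's identity for a spectrum of a set of measure one. -/
theorem IsSpectrum.hasSum_coeff (hvol : volume E = 1) (h : IsSpectrum E Λ) {f g : ℝ → ℂ}
    (hf : MemLp f 2 (volume.restrict E)) (hg : MemLp g 2 (volume.restrict E)) :
    HasSum (fun l : Λ => (∫ x in E, f x * expChar (-l) x) * conj (∫ x in E, g x * expChar (-l) x))
      (∫ x in E, f x * conj (g x)) := by
  obtain ⟨e, he, horth, hspan⟩ := h
  have hin : ∀ (l : Λ) (f : ℝ → ℂ) (hf : MemLp f 2 (volume.restrict E)),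
      inner ℂ (e l) hf.toLp = ∫ x in E, f x * expChar (-l) x := by
    intro l f hf
    rw [L2.inner_def]
    refine integral_congr_ae ?_
    filter_upwards [he l, hf.coeFn_toLp] with x hx hx'
    rw [RCLike.inner_apply, hx, hx', ← conj_expChar]; rfl
  have hnorm : ∀ l, ‖e l‖ = 1 := by
    intro l
    have h1 : (inner ℂ (e l) (e l) : ℂ) = 1 := by
      rw [L2.inner_def]
      have : ∀ᵐ x ∂volume.restrict E, (inner ℂ (e l x) (e l x) : ℂ) = 1 := by
        filter_upwards [he l] with x hx
        have h2 : e l x = expChar l x := hx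
        rw [inner_self_eq_norm_sq_to_K, h2, norm_expChar]; simp
      rw [integral_congr_ae this]
      simp [Measure.real, hvol]
    rw [inner_self_eq_norm_sq_to_K] at h1
    have h2 : ‖e l‖ ^ 2 = 1 := Complex.ofReal_injective (by push_cast; exact h1)
    exact (pow_eq_one_iff_of_nonneg (norm_nonneg _) two_ne_zero).1 h2
  let b := HilbertBasis.mk (𝕜 := ℂ) (v := e) ⟨hnorm, horth⟩ hspan.ge
  have hb : ∀ l, b l = e l := fun l => congrFun (HilbertBasis.coe_mk _ _) l
  have h1 := b.hasSum_inner_mul_inner hg.toLp hf.toLp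
  have h2 : inner ℂ hg.toLp hf.toLp = ∫ x in E, f x * conj (g x) := by
    rw [L2.inner_def]
    refine integral_congr_ae ?_
    filter_upwards [hf.coeFn_toLp, hg.coeFn_toLp] with x hx hx'
    rw [RCLike.inner_apply, hx, hx']
  rw [h2] at h1
  refine h1.congr_fun fun l => ?_
  rw [hb, ← inner_conj_symm, hin, hin, mul_comm]

/-- Orthogonal exponentials form a spectrum if no nonzero function is orthogonal to all of them. -/
theorem isSpectrum_of_total (hfin : volume E ≠ ⊤)
    (horth : ∀ l ∈ Λ, ∀ m ∈ Λ, l ≠ m → ∫ x in E, expChar (m - l) x = 0)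
    (htot : ∀ g : ℝ → ℂ, MemLp g 2 (volume.restrict E) →
      (∀ l ∈ Λ, ∫ x in E, g x * expChar (-l) x = 0) → g =ᵐ[volume.restrict E] 0) :
    IsSpectrum E Λ := by
  refine ⟨fun l => (memLp_expChar hfin l).toLp, fun l => (memLp_expChar hfin l).coeFn_toLp, ?_, ?_⟩
  · intro l m hlm
    rw [L2.inner_def, ← horth l l.2 m m.2 (fun h => hlm (Subtype.ext h))]
    refine integral_congr_ae ?_
    filter_upwards [(memLp_expChar hfin l).coeFn_toLp, (memLp_expChar hfin m).coeFn_toLp]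
      with x hx hx'
    rw [RCLike.inner_apply, hx, hx', conj_expChar, expChar_mul, sub_eq_add_neg]
  · rw [Submodule.topologicalClosure_eq_top_iff, Submodule.eq_bot_iff]
    intro g hg
    rw [Submodule.mem_orthogonal] at hg
    rw [Lp.eq_zero_iff_ae_eq_zero]
    refine htot g (Lp.memLp g) fun l hl => ?_
    rw [← hg _ (Submodule.subset_span ⟨⟨l, hl⟩, rfl⟩), L2.inner_def]
    refine integral_congr_ae ?_
    filter_upwards [(memLp_expChar hfin l).coeFn_toLp] with x hx
    rw [RCLike.inner_apply, hx, conj_expChar]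

end Spectrum

/-! ### The integers as a spectrum -/

section IntSpectrum

variable {E Λ : Set ℝ} {L : ℝ}

theorem setIntegral_expChar_intCast (hL : L < 3 / 2) (hE : MeasurableSet E) (hEL : E ⊆ Ioc 0 L)
    (hvol : volume E = 1) (h1 : volume (E ∩ (fun y => y + 1) ⁻¹' E) = 0) {n : ℤ} (hn : n ≠ 0) :
    ∫ x in E, expChar n x = 0 := by
  rw [setIntegral_of_periodic hL hE hEL hvol h1 (continuous_expChar n) (expChar_intCast_add_one n),
    intervalIntegral_expChar (by exact_mod_cast hn), (expChar_eq_one_iff n 1).2 ⟨n, by simp⟩]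
  simp

/-- A function on `E` orthogonal to all exponentials with integer frequencies folds to a function on
a period with vanishing Fourier coefficients. -/
theorem ae_eq_zero_of_forall_intCast (hL : L < 3 / 2) (hE : MeasurableSet E) (hEL : E ⊆ Ioc 0 L)
    (hvol : volume E = 1) (h1 : volume (E ∩ (fun y => y + 1) ⁻¹' E) = 0) {g : ℝ → ℂ}
    (hg : MemLp g 2 (volume.restrict E)) (h : ∀ n : ℤ, ∫ x in E, g x * expChar (-n) x = 0) :
    g =ᵐ[volume.restrict E] 0 := by
  obtain ⟨hd, hae⟩ := fold_ae_eq hL hE hEL hvol h1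
  set A := E ∩ Ioc 0 1
  set B := (fun y => y + 1) ⁻¹' (E ∩ Ioc (1 : ℝ) 2)
  have hA : MeasurableSet A := hE.inter measurableSet_Ioc
  have hB : MeasurableSet B := measurable_add_const 1 (hE.inter measurableSet_Ioc)
  have hmp : MeasurePreserving (fun x : ℝ => x + 1) (volume.restrict B)
      (volume.restrict (E ∩ Ioc (1 : ℝ) 2)) :=
    (measurePreserving_add_right volume (1 : ℝ)).restrict_preimage (hE.inter measurableSet_Ioc)
  have hgA : MemLp (A.indicator g) 2 volume :=
    (memLp_indicator_iff_restrict hA).2 (hg.mono_measure (Measure.restrict_mono_set _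
      inter_subset_left))
  have hgB' : MemLp (fun x => g (x + 1)) 2 (volume.restrict B) :=
    (hg.mono_measure (Measure.restrict_mono_set _ inter_subset_left)).comp_measurePreserving hmp
  have hgB : MemLp (B.indicator fun x => g (x + 1)) 2 volume :=
    (memLp_indicator_iff_restrict hB).2 hgB'
  set G : ℝ → ℂ := A.indicator g + B.indicator fun x => g (x + 1) with hG
  have hGm : MemLp G 2 (volume.restrict (Ioc 0 1)) := (hgA.add hgB).restrict _
  have hA1 : A ⊆ Ioc 0 1 := inter_subset_right
  have hB1 : B ⊆ Ioc 0 1 := by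
    intro y hy
    have := hy.2
    simp only [mem_Ioc] at this ⊢
    constructor <;> linarith [this.1, this.2]
  have hfinE : IsFiniteMeasure (volume.restrict E) := ⟨by simp [hvol]⟩
  have hcoeff : ∀ n : ℤ, fourierCoeffOn (zero_lt_one' ℝ) G n = 0 := by
    intro n
    rw [fourierCoeffOn_eq_integral, ← h n,
      setIntegral_fold hL hE hEL ((hg.mul_expChar (-n)).integrable (by norm_num))]
    have e1 : ∀ x : ℝ, (fourier (-n) (x : AddCircle ((1 : ℝ) - 0)) : ℂ) = expChar (-n) x := by
      intro x
      rw [fourier_coe_apply, expChar]; congr 1; push_cast; ring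
    have e2 : ∀ x : ℝ, expChar (-n) (x + 1) = expChar (-n) x := by
      intro x; exact_mod_cast expChar_intCast_add_one (-n) x
    simp only [e1, e2, sub_zero, div_one, one_smul, smul_eq_mul]
    rw [intervalIntegral.integral_of_le zero_le_one]
    have e3 : ∀ x, expChar (-n) x * G x = A.indicator (fun x => g x * expChar (-n) x) x +
        B.indicator (fun x => g (x + 1) * expChar (-n) x) x := by
      intro x
      simp only [hG, Pi.add_apply, indicator]
      split_ifs <;> ring
    simp only [e3]
    have i1 : IntegrableOn (A.indicator (fun x => g x * expChar (-n) x)) (Ioc 0 1) := by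
      refine ((integrable_indicator_iff hA).2 ?_).integrableOn
      have : MemLp g 2 (volume.restrict A) :=
        hg.mono_measure (Measure.restrict_mono_set _ inter_subset_left)
      have hf : IsFiniteMeasure (volume.restrict A) :=
        ⟨by simpa using (measure_ne_top_of_subset_Ioc hA1).lt_top⟩
      exact (this.mul_expChar (-n)).integrable (by norm_num)
    have i2 : IntegrableOn (B.indicator (fun x => g (x + 1) * expChar (-n) x)) (Ioc 0 1) := by
      refine ((integrable_indicator_iff hB).2 ?_).integrableOn
      have hf : IsFiniteMeasure (volume.restrict B) :=
        ⟨by simpa using (measure_ne_top_of_subset_Ioc hB1).lt_top⟩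
      exact (hgB'.mul_expChar (-n)).integrable (by norm_num)
    rw [integral_add i1 i2, setIntegral_indicator hA, setIntegral_indicator hB,
      inter_eq_right.2 hA1, inter_eq_right.2 hB1]
  have hsum := hasSum_sq_fourierCoeffOn (zero_lt_one' ℝ) hGm
  simp only [hcoeff, norm_zero, ne_eq, OfNat.ofNat_ne_zero, not_false_eq_true, zero_pow] at hsum
  have hint : ∫ x in Ioc (0 : ℝ) 1, ‖G x‖ ^ 2 = 0 := by
    have := hsum.unique hasSum_zero
    rw [intervalIntegral.integral_of_le zero_le_one] at this
    simpa using this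
  rw [integral_eq_zero_iff_of_nonneg (fun x => by positivity) (by
    simpa using hGm.integrable_norm_pow (by norm_num))] at hint
  have hG0 : ∀ᵐ x, x ∈ Ioc (0 : ℝ) 1 → G x = 0 := by
    rw [Filter.EventuallyEq, ae_restrict_iff' measurableSet_Ioc] at hint
    filter_upwards [hint] with x hx hxI
    simpa using hx hxI
  have hAB : ∀ᵐ x, ¬ (x ∈ A ∧ x ∈ B) := by
    refine measure_mono_null (fun x hx => ?_) hd
    simpa using hx
  have hzA : ∀ᵐ x, x ∈ A → g x = 0 := by
    filter_upwards [hG0, hAB] with x hx hx' hxA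
    have := hx (hA1 hxA)
    rwa [hG, Pi.add_apply, indicator_of_mem hxA, indicator_of_notMem fun hb => hx' ⟨hxA, hb⟩,
      add_zero] at this
  have hzB : ∀ᵐ x, x ∈ B → g (x + 1) = 0 := by
    filter_upwards [hG0, hAB] with x hx hx' hxB
    have := hx (hB1 hxB)
    rwa [hG, Pi.add_apply, indicator_of_mem hxB, indicator_of_notMem fun ha => hx' ⟨ha, hxB⟩,
      zero_add] at this
  have hzB' := (measurePreserving_add_right volume (-1 : ℝ)).quasiMeasurePreserving.ae hzB
  rw [Filter.EventuallyEq, ae_restrict_iff' hE]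
  filter_upwards [hzA, hzB'] with x hxA hxB hxE
  by_cases hx1 : x ≤ 1
  · exact hxA ⟨hxE, (hEL hxE).1, hx1⟩
  · have h2 : x + -1 ∈ B := by
      refine ⟨by simpa using hxE, ?_⟩
      have := hEL hxE
      simp only [mem_Ioc] at this ⊢
      constructor <;> linarith [this.1, this.2]
    simpa using hxB h2

theorem isSpectrum_intCast (hL : L < 3 / 2) (hE : MeasurableSet E) (hEL : E ⊆ Ioc 0 L)
    (hvol : volume E = 1) (h1 : volume (E ∩ (fun y => y + 1) ⁻¹' E) = 0) :
    IsSpectrum E (range ((↑) : ℤ → ℝ)) := by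
  refine isSpectrum_of_total (by simp [hvol]) ?_ ?_
  · rintro _ ⟨m, rfl⟩ _ ⟨n, rfl⟩ hmn
    rw [← Int.cast_sub]
    exact setIntegral_expChar_intCast hL hE hEL hvol h1
      (sub_ne_zero.2 fun h => hmn (by rw [h]))
  · intro g hg h
    exact ae_eq_zero_of_forall_intCast hL hE hEL hvol h1 hg fun n => h _ ⟨n, rfl⟩

/-- If all frequencies of a spectrum agree modulo one, then the exponentials take proportional
values at `x` and `x + 1`, so completeness excludes that both points lie in `E`. -/
theorem IsSpectrum.measure_overlap_one (hL : L < 3 / 2) (hE : MeasurableSet E) (hEL : E ⊆ Ioc 0 L)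
    (hvol : volume E = 1) (hS : IsSpectrum E Λ)
    (hdiff : ∀ l ∈ Λ, ∀ m ∈ Λ, ∃ n : ℤ, l - m = n) :
    volume (E ∩ (fun y => y + 1) ⁻¹' E) = 0 := by
  obtain ⟨c, hc⟩ : ∃ c : ℂ, ∀ l ∈ Λ, c * expChar (-l) 1 = 1 := by
    rcases Λ.eq_empty_or_nonempty with rfl | ⟨l₀, hl₀⟩
    · exact ⟨0, by simp⟩
    · refine ⟨expChar l₀ 1, fun l hl => ?_⟩
      rw [expChar_mul, expChar_eq_one_iff]
      obtain ⟨n, hn⟩ := hdiff l₀ hl₀ l hl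
      exact ⟨n, by rw [← hn]; ring⟩
  set A := E ∩ (fun y => y + 1) ⁻¹' E
  set B := (fun y : ℝ => y + -1) ⁻¹' A
  have hA : MeasurableSet A := hE.inter (measurable_add_const 1 hE)
  have hB : MeasurableSet B := measurable_add_const (-1) hA
  have hBE : B ⊆ E := fun x hx => by simpa [A, B] using hx.2
  have hAE : A ⊆ E := inter_subset_left
  have hfin : ∀ {s : Set ℝ}, s ⊆ E → volume s ≠ ⊤ := fun hs =>
    measure_ne_top_of_subset_Ioc (hs.trans hEL)
  have hmA : MemLp (A.indicator fun _ => (1 : ℂ)) 2 (volume.restrict E) :=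
    (memLp_indicator_const 2 hA 1 (Or.inr (hfin hAE))).restrict E
  have hmB : MemLp (B.indicator fun _ => c) 2 (volume.restrict E) :=
    (memLp_indicator_const 2 hB c (Or.inr (hfin hBE))).restrict E
  have hsum := hS.hasSum_coeff hvol hmA (hmA.sub hmB)
  have hcoeff : ∀ l ∈ Λ, ∫ x in E, ((A.indicator fun _ => (1 : ℂ)) - B.indicator fun _ => c) x *
      expChar (-l) x = 0 := by
    intro l hl
    have e1 : ∀ x, ((A.indicator fun _ => (1 : ℂ)) - B.indicator fun _ => c) x *
        expChar (-l) x = A.indicator (expChar (-l)) x - B.indicator (fun x => c * expChar (-l) x) x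
        := by
      intro x
      simp only [Pi.sub_apply, indicator]
      split_ifs <;> ring
    have hi : IntegrableOn (expChar (-l)) E := (continuous_expChar _).integrableOn_Ioc.mono_set hEL
    have e2 : ∫ x in B, c * expChar (-l) x = ∫ x in A, expChar (-l) x := by
      have := (measurePreserving_add_right volume (1 : ℝ)).setIntegral_preimage_emb
        (measurableEmbedding_addRight 1) (fun x => c * expChar (-l) x) B
      rw [← this]
      have hAB : (fun x : ℝ => x + 1) ⁻¹' B = A := by ext x; simp [B]
      rw [hAB]
      refine integral_congr_ae (Filter.Eventually.of_forall fun x => ?_)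
      simp only [expChar_add]
      rw [mul_left_comm, hc l hl, mul_one]
    simp only [e1]
    rw [integral_sub ((hi.integrable).indicator hA)
      ((hi.integrable.const_mul c).indicator hB), setIntegral_indicator hA, setIntegral_indicator hB,
      inter_eq_right.2 hAE, inter_eq_right.2 hBE, e2, sub_self]
  have h0 := hsum.unique (hasSum_zero.congr_fun fun l => by
    rw [hcoeff l l.2, map_zero, mul_zero])
  have e3 : ∀ x, (A.indicator fun _ => (1 : ℂ)) x *
      conj (((A.indicator fun _ => (1 : ℂ)) - B.indicator fun _ => c) x) =
      A.indicator (fun _ => (1 : ℂ)) x := by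
    intro x
    by_cases hx : x ∈ A
    · have hxB : x ∉ B := by
        intro hb
        have h2 := (hEL hb.1).1
        have h3 := (hEL hx.2).2
        simp only at h2 h3
        linarith
      simp [indicator_of_mem hx, indicator_of_notMem hxB]
    · simp [indicator_of_notMem hx]
  simp only [e3] at h0
  rw [setIntegral_indicator hA, inter_eq_right.2 hAE, setIntegral_const, Complex.real_smul,
    mul_one, Complex.ofReal_eq_zero, measureReal_eq_zero_iff (hfin hAE)] at h0
  exact h0

/-- No proper subset of the integers is complete. -/
theorem IsSpectrum.eq_range_intCast (hL : L < 3 / 2) (hE : MeasurableSet E) (hEL : E ⊆ Ioc 0 L)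
    (hvol : volume E = 1) (hS : IsSpectrum E Λ) (hΛ : Λ ⊆ range ((↑) : ℤ → ℝ)) :
    Λ = range ((↑) : ℤ → ℝ) := by
  have h1 : volume (E ∩ (fun y => y + 1) ⁻¹' E) = 0 := by
    refine hS.measure_overlap_one hL hE hEL hvol fun l hl m hm => ?_
    obtain ⟨a, rfl⟩ := hΛ hl
    obtain ⟨b, rfl⟩ := hΛ hm
    exact ⟨a - b, by push_cast; rfl⟩
  refine hΛ.antisymm ?_
  rintro _ ⟨n, rfl⟩
  by_contra hn
  have hm := memLp_expChar (E := E) (by simp [hvol]) n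
  have hsum := hS.hasSum_coeff hvol hm hm
  have h0 := hsum.unique (hasSum_zero.congr_fun fun l => by
    obtain ⟨k, hk⟩ := hΛ l.2
    have : ∫ x in E, expChar n x * expChar (-l) x = 0 := by
      rw [← setIntegral_expChar_intCast hL hE hEL hvol h1 (n := n - k)
        (sub_ne_zero.2 fun h => hn (by rw [h, hk]; exact l.2))]
      simp only [expChar_mul]
      push_cast
      rw [hk, sub_eq_add_neg]
    rw [this, zero_mul])
  simp only [conj_expChar, expChar_mul, add_neg_cancel, expChar_zero] at h0
  simp [Measure.real, hvol] at h0

end IntSpectrum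

/-! ### Translates of `E` containing most of the mass of two functions -/

/-- Around a density point, a set of positive measure misses only a small part of a ball. -/
theorem exists_measure_closedBall_diff_le {A : Set ℝ} (hA : MeasurableSet A) (h : volume A ≠ 0)
    {ε : ℝ} (hε : 0 < ε) :
    ∃ p : ℝ, ∃ r > 0, volume (Metric.closedBall p (2 * r) \ A) ≤ ENNReal.ofReal (ε * r) := by
  have hne : volume.restrict A ≠ 0 := by simpa using h
  have : (ae (volume.restrict A)).NeBot := ae_neBot.2 hne
  obtain ⟨p, hp⟩ := (Besicovitch.ae_tendsto_measure_inter_div volume A).exists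
  obtain ⟨c, hc1, hc0, hc⟩ : ∃ c : ℝ, c < 1 ∧ 0 ≤ c ∧ (1 - c) * 4 ≤ ε :=
    ⟨max (1 - ε / 4) 0, max_lt (by linarith) one_pos, le_max_right _ _, by
      linarith [le_max_left (1 - ε / 4) 0]⟩
  have hc1' : ENNReal.ofReal c < 1 := by
    rw [← ENNReal.ofReal_one]; exact (ENNReal.ofReal_lt_ofReal_iff one_pos).2 hc1
  obtain ⟨r, hr, hr0⟩ := ((hp.eventually (lt_mem_nhds hc1')).and self_mem_nhdsWithin).exists
  have hr0 : 0 < r := hr0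
  refine ⟨p, r / 2, by linarith, ?_⟩
  rw [show 2 * (r / 2) = r by ring]
  have hB : volume (Metric.closedBall p r) = ENNReal.ofReal (2 * r) := Real.volume_closedBall p r
  have hBtop : volume (Metric.closedBall p r) ≠ ⊤ := by rw [hB]; exact ENNReal.ofReal_ne_top
  have h1 : ENNReal.ofReal c * ENNReal.ofReal (2 * r) ≤ volume (A ∩ Metric.closedBall p r) := by
    rw [← hB]
    exact ((ENNReal.lt_div_iff_mul_lt (Or.inl (by
      rw [hB]; simpa using hr0)) (Or.inl hBtop)).1 hr).le
  have h2 := measure_sdiff_add_inter (μ := volume) (Metric.closedBall p r) hA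
  rw [inter_comm] at h1
  rw [← ENNReal.ofReal_mul hc0] at h1
  rw [hB] at h2
  have h3 : volume (Metric.closedBall p r \ A) ≤
      ENNReal.ofReal (2 * r) - ENNReal.ofReal (c * (2 * r)) := by
    refine ENNReal.le_sub_of_add_le_right ENNReal.ofReal_ne_top ?_
    rw [← h2]
    exact add_le_add le_rfl h1
  rw [← ENNReal.ofReal_sub _ (by positivity)] at h3
  refine h3.trans (ENNReal.ofReal_le_ofReal ?_)
  nlinarith

/-- Averaging over translates by `a ∈ W`: the mass that `u` has outside `E + a` is on average at
most the proportion of those `a` for which a given point of the support lies outside `E + a`. -/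
theorem lintegral_setLIntegral_compl_le {E S W : Set ℝ} (hE : MeasurableSet E)
    {u : ℝ → ℝ≥0∞} (hu : AEMeasurable u) (hS : ∀ y ∉ S, u y = 0) {c : ℝ≥0∞}
    (hc : ∀ y ∈ S, volume ({a | y - a ∉ E} ∩ W) ≤ c) :
    ∫⁻ a in W, ∫⁻ y in {y | y - a ∉ E}, u y ≤ c * ∫⁻ y, u y := by
  have hm : ∀ a : ℝ, MeasurableSet {y : ℝ | y - a ∉ E} := fun a =>
    (measurable_sub_const a hE).compl
  have hm' : ∀ y : ℝ, MeasurableSet {a : ℝ | y - a ∉ E} := fun y =>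
    (measurable_const_sub y hE).compl
  have hmm : MeasurableSet {q : ℝ × ℝ | q.2 - q.1 ∉ E} :=
    (measurable_snd.sub measurable_fst hE).compl
  have e1 : ∀ a, ∫⁻ y in {y | y - a ∉ E}, u y =
      ∫⁻ y, {q : ℝ × ℝ | q.2 - q.1 ∉ E}.indicator (fun q => u q.2) (a, y) := by
    intro a
    rw [← lintegral_indicator (hm a)]
    rfl
  simp only [e1]
  rw [lintegral_lintegral_swap
    (f := fun a y => {q : ℝ × ℝ | q.2 - q.1 ∉ E}.indicator (fun q => u q.2) (a, y))
    (hu.comp_snd.indicator hmm), ← lintegral_const_mul'' c hu]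
  refine lintegral_mono fun y => ?_
  have e2 : ∀ a, {q : ℝ × ℝ | q.2 - q.1 ∉ E}.indicator (fun q => u q.2) (a, y) =
      {a : ℝ | y - a ∉ E}.indicator (fun _ => u y) a := fun a => rfl
  simp only [e2]
  rw [lintegral_indicator_const (hm' y), Measure.restrict_apply (hm' y), mul_comm]
  by_cases hy : y ∈ S
  · exact mul_le_mul' (hc y hy) le_rfl
  · simp [hS y hy]

/-- If `E` and `E - d` overlap in positive measure, then for functions `u` and `v` supported close
to `s` and `s + d` some translate of `E` contains all but a small part of the mass of both: it is
one that moves a density point of the overlap close to `s`. -/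
theorem exists_translate_capture {E : Set ℝ} (hE : MeasurableSet E) {d : ℝ}
    (hd : volume (E ∩ (fun y => y + d) ⁻¹' E) ≠ 0) {η : ℝ} (hη : 0 < η) :
    ∃ δ > 0, ∀ (s : ℝ) (u v : ℝ → ℝ≥0∞), AEMeasurable u → AEMeasurable v →
      (∀ y ∉ Metric.closedBall s δ, u y = 0) → (∀ y ∉ Metric.closedBall (s + d) δ, v y = 0) →
      ∫⁻ y, u y ≠ 0 → ∫⁻ y, v y ≠ 0 → ∫⁻ y, u y ≠ ⊤ → ∫⁻ y, v y ≠ ⊤ →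
      ∃ a, ∫⁻ y in {y | y - a ∉ E}, u y ≤ ENNReal.ofReal η * ∫⁻ y, u y ∧
        ∫⁻ y in {y | y - a ∉ E}, v y ≤ ENNReal.ofReal η * ∫⁻ y, v y := by
  set A := E ∩ (fun y => y + d) ⁻¹' E with hAdef
  have hA : MeasurableSet A := hE.inter (measurable_add_const d hE)
  obtain ⟨p, δ, hδ, hp⟩ := exists_measure_closedBall_diff_le hA hd (half_pos hη)
  refine ⟨δ, hδ, fun s u v hu hv hus hvs hu0 hv0 hut hvt => ?_⟩
  set W := Metric.closedBall (s - p) δ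
  set c := ENNReal.ofReal (η / 2 * δ) with hc
  have hbad : ∀ y ∈ Metric.closedBall s δ, volume ({a | y - a ∉ A} ∩ W) ≤ c := by
    intro y hy
    have hBm : MeasurableSet (Metric.closedBall p (2 * δ) \ A) :=
      Metric.isClosed_closedBall.measurableSet.diff hA
    refine le_trans ?_ hp
    rw [← (Measure.measurePreserving_sub_left volume y).measure_preimage hBm.nullMeasurableSet]
    refine measure_mono fun a ha => mem_preimage.2 ⟨?_, mem_ofPred.1 ha.1⟩
    have h1 := Metric.mem_closedBall.1 hy
    have h2 := Metric.mem_closedBall.1 ha.2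
    rw [Real.dist_eq, abs_le] at h1 h2
    rw [Metric.mem_closedBall, Real.dist_eq, abs_le]
    constructor <;> linarith [h1.1, h1.2, h2.1, h2.2]
  have hbad' : ∀ y ∈ Metric.closedBall s δ ∪ Metric.closedBall (s + d) δ,
      volume ({a | y - a ∉ E} ∩ W) ≤ c := by
    rintro y (hy | hy)
    · refine (measure_mono ?_).trans (hbad y hy)
      exact fun a ha => ⟨fun h => ha.1 h.1, ha.2⟩
    · refine (measure_mono ?_).trans (hbad (y - d) ?_)
      · refine fun a ha => ⟨fun h => ha.1 ?_, ha.2⟩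
        have := h.2
        simp only [mem_preimage] at this
        rwa [show y - d - a + d = y - a by ring] at this
      · rw [Metric.mem_closedBall, Real.dist_eq] at hy ⊢
        rwa [show y - d - s = y - (s + d) by ring]
  set U := ∫⁻ y, u y
  set V := ∫⁻ y, v y
  -- the sum of the two functions, each normalized to have total mass one
  have hsplit : ∀ μ : Measure ℝ, μ ≤ volume → ∫⁻ y, (U⁻¹ * u y + V⁻¹ * v y) ∂μ =
      U⁻¹ * ∫⁻ y, u y ∂μ + V⁻¹ * ∫⁻ y, v y ∂μ := by
    intro μ hμ
    rw [lintegral_add_left' ((hu.mono_measure hμ).const_mul _),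
      lintegral_const_mul'' _ (hu.mono_measure hμ), lintegral_const_mul'' _ (hv.mono_measure hμ)]
  have hup := lintegral_setLIntegral_compl_le (W := W) hE (u := fun y => U⁻¹ * u y + V⁻¹ * v y)
    ((hu.const_mul _).add (hv.const_mul _))
    (S := Metric.closedBall s δ ∪ Metric.closedBall (s + d) δ) (fun y hy => by
      rw [mem_union, not_or] at hy
      simp [hus y hy.1, hvs y hy.2]) hbad'
  rw [hsplit _ le_rfl, ENNReal.inv_mul_cancel hu0 hut, ENNReal.inv_mul_cancel hv0 hvt] at hup
  by_contra! hcon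
  have hlow : ∀ a, ENNReal.ofReal η ≤
      ∫⁻ y in {y | y - a ∉ E}, (U⁻¹ * u y + V⁻¹ * v y) := by
    intro a
    rw [hsplit _ Measure.restrict_le_self]
    by_cases h : ∫⁻ y in {y | y - a ∉ E}, u y ≤ ENNReal.ofReal η * U
    · calc ENNReal.ofReal η = V⁻¹ * (ENNReal.ofReal η * V) := by
            rw [mul_left_comm, ENNReal.inv_mul_cancel hv0 hvt, mul_one]
        _ ≤ V⁻¹ * ∫⁻ y in {y | y - a ∉ E}, v y := mul_le_mul' le_rfl (hcon a h).le
        _ ≤ _ := le_add_self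
    · calc ENNReal.ofReal η = U⁻¹ * (ENNReal.ofReal η * U) := by
            rw [mul_left_comm, ENNReal.inv_mul_cancel hu0 hut, mul_one]
        _ ≤ U⁻¹ * ∫⁻ y in {y | y - a ∉ E}, u y := mul_le_mul' le_rfl (not_le.1 h).le
        _ ≤ _ := le_self_add
  have hlow' := lintegral_mono (μ := volume.restrict W) hlow
  rw [lintegral_const, Measure.restrict_apply_univ, Real.volume_closedBall] at hlow'
  have h := hlow'.trans hup
  rw [hc, one_add_one_eq_two, ← ENNReal.ofReal_ofNat 2, ← ENNReal.ofReal_mul hη.le,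
    ← ENNReal.ofReal_mul (by positivity), ENNReal.ofReal_le_ofReal_iff (by positivity)] at h
  nlinarith [mul_pos hη hδ]

/-! ### Square-integrable functions on short intervals -/

/-- The Fourier coefficient of `h` at the frequency `l`, an integral over the whole line. -/
noncomputable def coeff (l : ℝ) (h : ℝ → ℂ) : ℂ := ∫ x, h x * expChar (-l) x

/-- The square of the `L²` norm. -/
noncomputable def energy (h : ℝ → ℂ) : ℝ := ∫ x, ‖h x‖ ^ 2

/-- Square-integrable functions vanishing off the closed ball of radius `δ` around `s`. -/
structure MemL2Ball (h : ℝ → ℂ) (s δ : ℝ) : Prop where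
  memLp : MemLp h 2 volume
  eq_zero : ∀ y ∉ Metric.closedBall s δ, h y = 0

theorem energy_nonneg (h : ℝ → ℂ) : 0 ≤ energy h := integral_nonneg fun _ => by positivity

theorem integrable_norm_sq {h : ℝ → ℂ} (hh : MemLp h 2 volume) :
    Integrable fun x => ‖h x‖ ^ 2 := by
  simpa using hh.integrable_norm_pow (by norm_num)

theorem norm_integral_mul_conj_le {h k : ℝ → ℂ} (hh : MemLp h 2 volume) (hk : MemLp k 2 volume) :
    ‖∫ x, h x * conj (k x)‖ ≤ √(energy h) * √(energy k) := by
  have key : ∀ {f g : ℝ → ℂ} (hf : MemLp f 2 volume) (hg : MemLp g 2 volume),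
      (inner ℂ hg.toLp hf.toLp : ℂ) = ∫ x, f x * conj (g x) := by
    intro f g hf hg
    rw [L2.inner_def]
    refine integral_congr_ae ?_
    filter_upwards [hf.coeFn_toLp, hg.coeFn_toLp] with x hx hx'
    rw [RCLike.inner_apply, hx, hx']
  have hnorm : ∀ {f : ℝ → ℂ} (hf : MemLp f 2 volume), ‖hf.toLp‖ = √(energy f) := by
    intro f hf
    have h1 := key hf hf
    rw [inner_self_eq_norm_sq_to_K] at h1
    have h2 : ∫ x, f x * conj (f x) = ((energy f : ℝ) : ℂ) := by
      rw [energy, ← integral_complex_ofReal]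
      refine integral_congr_ae (Filter.Eventually.of_forall fun x => ?_)
      simp only [Complex.mul_conj']
      push_cast; rfl
    rw [h2] at h1
    have h3 : ‖hf.toLp‖ ^ 2 = energy f := Complex.ofReal_injective (by push_cast; exact h1)
    rw [← h3, Real.sqrt_sq (norm_nonneg _)]
  rw [← key hh hk, ← hnorm hh, ← hnorm hk, mul_comm]
  exact norm_inner_le_norm _ _

theorem energy_indicator {S : Set ℝ} (hS : MeasurableSet S) (h : ℝ → ℂ) :
    energy (S.indicator h) = ∫ x in S, ‖h x‖ ^ 2 := by
  rw [energy, ← integral_indicator hS]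
  refine integral_congr_ae (Filter.Eventually.of_forall fun x => ?_)
  by_cases hx : x ∈ S <;> simp [hx]

theorem energy_indicator_le {S : Set ℝ} (hS : MeasurableSet S) {h : ℝ → ℂ}
    (hh : MemLp h 2 volume) : energy (S.indicator h) ≤ energy h := by
  rw [energy_indicator hS]
  exact setIntegral_le_integral (integrable_norm_sq hh)
    (Filter.Eventually.of_forall fun _ => by positivity)

namespace MemL2Ball

variable {h : ℝ → ℂ} {s δ : ℝ}

theorem indicator (hh : MemL2Ball h s δ) {S : Set ℝ} (hS : MeasurableSet S) :
    MemL2Ball (S.indicator h) s δ :=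
  ⟨hh.memLp.indicator hS, fun y hy => by simp [hh.eq_zero y hy]⟩

theorem mono (hh : MemL2Ball h s δ) {s' δ' : ℝ}
    (hsub : Metric.closedBall s δ ⊆ Metric.closedBall s' δ') : MemL2Ball h s' δ' :=
  ⟨hh.memLp, fun y hy => hh.eq_zero y fun h' => hy (hsub h')⟩

theorem integrable (hh : MemL2Ball h s δ) : Integrable h := by
  have hf : IsFiniteMeasure (volume.restrict (Metric.closedBall s δ)) :=
    ⟨by simpa only [Measure.restrict_apply_univ] using measure_closedBall_lt_top⟩
  have h1 : IntegrableOn h (Metric.closedBall s δ) :=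
    (hh.memLp.restrict _).integrable (by norm_num)
  exact (integrableOn_iff_integrable_of_support_subset fun y hy => by
    by_contra hc; exact hy (hh.eq_zero y hc)).1 h1

theorem norm_coeff_sq_le (hh : MemL2Ball h s δ) (hδ : 0 < δ) (l : ℝ) :
    ‖coeff l h‖ ^ 2 ≤ 2 * δ * energy h := by
  have hB : MeasurableSet (Metric.closedBall s δ) := Metric.isClosed_closedBall.measurableSet
  have hk : MemLp ((Metric.closedBall s δ).indicator (expChar l)) 2 volume :=
    (memLp_indicator_iff_restrict hB).2 (memLp_expChar measure_closedBall_lt_top.ne l)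
  have h1 := norm_integral_mul_conj_le hh.memLp hk
  have h2 : ∫ x, h x * conj ((Metric.closedBall s δ).indicator (expChar l) x) = coeff l h := by
    refine integral_congr_ae (Filter.Eventually.of_forall fun x => ?_)
    by_cases hx : x ∈ Metric.closedBall s δ
    · simp only [indicator_of_mem hx, conj_expChar]
    · simp [hh.eq_zero x hx]
  have h3 : energy ((Metric.closedBall s δ).indicator (expChar l)) = 2 * δ := by
    rw [energy_indicator hB]
    simp only [norm_expChar, one_pow]
    simp [Measure.real, Real.volume_closedBall, hδ.le]
  rw [h2, h3] at h1
  calc ‖coeff l h‖ ^ 2 ≤ (√(energy h) * √(2 * δ)) ^ 2 := by gcongr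
    _ = 2 * δ * energy h := by
      rw [mul_pow, Real.sq_sqrt (energy_nonneg h), Real.sq_sqrt (by positivity), mul_comm]

end MemL2Ball

theorem integrable_mul_expChar {h : ℝ → ℂ} (hh : Integrable h) (l : ℝ) :
    Integrable fun x => h x * expChar l x :=
  hh.mul_bdd (c := 1) (continuous_expChar l).aestronglyMeasurable
    (Filter.Eventually.of_forall fun x => (norm_expChar l x).le)

theorem coeff_add {h k : ℝ → ℂ} (hh : Integrable h) (hk : Integrable k) (l : ℝ) :
    coeff l (h + k) = coeff l h + coeff l k := by
  simp only [coeff, Pi.add_apply, add_mul]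
  exact integral_add (integrable_mul_expChar hh _) (integrable_mul_expChar hk _)

theorem integrable_mul_conj {h k : ℝ → ℂ} (hh : MemLp h 2 volume) (hk : MemLp k 2 volume) :
    Integrable fun x => h x * conj (k x) := by
  have : MemLp (fun x => conj (k x)) 2 volume :=
    hk.of_le (Complex.continuous_conj.comp_aestronglyMeasurable hk.1)
      (Filter.Eventually.of_forall fun x => by simp)
  exact hh.integrable_mul this

theorem exists_translate_energy_le {E : Set ℝ} (hE : MeasurableSet E) {d : ℝ}
    (hd : volume (E ∩ (fun y => y + d) ⁻¹' E) ≠ 0) {η : ℝ} (hη : 0 < η) :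
    ∃ δ > 0, ∀ (s : ℝ) (h k : ℝ → ℂ), MemL2Ball h s δ → MemL2Ball k (s + d) δ →
      energy h ≠ 0 → energy k ≠ 0 →
      ∃ a, energy ({y | y - a ∈ E}ᶜ.indicator h) ≤ η * energy h ∧
        energy ({y | y - a ∈ E}ᶜ.indicator k) ≤ η * energy k := by
  obtain ⟨δ, hδ, H⟩ := exists_translate_capture hE hd hη
  refine ⟨δ, hδ, fun s h k hh hk hh0 hk0 => ?_⟩
  have e : ∀ {f : ℝ → ℂ} (hf : MemLp f 2 volume) (S : Set ℝ),
      ∫⁻ y in S, ENNReal.ofReal (‖f y‖ ^ 2) = ENNReal.ofReal (∫ y in S, ‖f y‖ ^ 2) := fun hf S =>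
    (ofReal_integral_eq_lintegral_ofReal (integrable_norm_sq hf).integrableOn
      (Filter.Eventually.of_forall fun _ => by positivity)).symm
  have e' : ∀ {f : ℝ → ℂ} (hf : MemLp f 2 volume),
      ∫⁻ y, ENNReal.ofReal (‖f y‖ ^ 2) = ENNReal.ofReal (energy f) := fun hf => by
    simpa [energy] using e hf univ
  have hz : ∀ {f : ℝ → ℂ} {s : ℝ}, MemL2Ball f s δ → ∀ y ∉ Metric.closedBall s δ,
      ENNReal.ofReal (‖f y‖ ^ 2) = 0 := fun hf y hy => by simp [hf.eq_zero y hy]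
  have hne : ∀ {f : ℝ → ℂ}, energy f ≠ 0 → ENNReal.ofReal (energy f) ≠ 0 := fun {f} hf => by
    simpa using lt_of_le_of_ne (energy_nonneg f) hf.symm
  obtain ⟨a, ha, ha'⟩ := H s _ _ (integrable_norm_sq hh.memLp).aemeasurable.ennreal_ofReal
    (integrable_norm_sq hk.memLp).aemeasurable.ennreal_ofReal (hz hh) (hz hk)
    (by rw [e' hh.memLp]; exact hne hh0) (by rw [e' hk.memLp]; exact hne hk0)
    (by rw [e' hh.memLp]; exact ENNReal.ofReal_ne_top)
    (by rw [e' hk.memLp]; exact ENNReal.ofReal_ne_top)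
  have hS : MeasurableSet {y : ℝ | y - a ∈ E} := measurable_sub_const a hE
  rw [e hh.memLp, e' hh.memLp, ← ENNReal.ofReal_mul hη.le,
    ENNReal.ofReal_le_ofReal_iff (mul_nonneg hη.le (energy_nonneg h))] at ha
  rw [e hk.memLp, e' hk.memLp, ← ENNReal.ofReal_mul hη.le,
    ENNReal.ofReal_le_ofReal_iff (mul_nonneg hη.le (energy_nonneg k))] at ha'
  refine ⟨a, ?_, ?_⟩
  · rw [energy_indicator hS.compl]; exact ha
  · rw [energy_indicator hS.compl]; exact ha'

/-! ### Parseval's identity away from `E` -/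

section Spectrum

variable {E Λ : Set ℝ}

/-- Parseval's identity for functions supported in a translate of `E`. -/
theorem IsSpectrum.hasSum_translate (hvol : volume E = 1)
    (hS : IsSpectrum E Λ) (a : ℝ) {f g : ℝ → ℂ} (hf : MemLp f 2 volume) (hg : MemLp g 2 volume)
    (hf0 : ∀ y, y - a ∉ E → f y = 0) (hg0 : ∀ y, y - a ∉ E → g y = 0) :
    HasSum (fun l : Λ => coeff l f * conj (coeff l g)) (∫ x, f x * conj (g x)) := by
  have hmp := measurePreserving_add_right volume a
  have h1 := hS.hasSum_coeff hvol ((hf.comp_measurePreserving hmp).restrict E)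
    ((hg.comp_measurePreserving hmp).restrict E)
  have hc : ∀ {f : ℝ → ℂ}, (∀ y, y - a ∉ E → f y = 0) → ∀ l : ℝ,
      ∫ x in E, (f ∘ fun x => x + a) x * expChar (-l) x = expChar (-l) (-a) * coeff l f := by
    intro f hf0 l
    rw [setIntegral_eq_integral_of_forall_compl_eq_zero fun x hx => by
      simp [hf0 (x + a) (by simpa using hx)], coeff, ← integral_const_mul,
      ← integral_add_right_eq_self (fun x => expChar (-l) (-a) * (f x * expChar (-l) x)) a]
    refine integral_congr_ae (Filter.Eventually.of_forall fun x => ?_)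
    simp only [Function.comp]
    rw [mul_left_comm, mul_comm (expChar (-l) (-a)), ← expChar_add, add_neg_cancel_right]
  rw [setIntegral_eq_integral_of_forall_compl_eq_zero fun x hx => by
    simp [hf0 (x + a) (by simpa using hx)]] at h1
  have h2 : ∫ x, (f ∘ fun x => x + a) x * conj ((g ∘ fun x => x + a) x) =
      ∫ x, f x * conj (g x) := integral_add_right_eq_self (fun x => f x * conj (g x)) a
  rw [h2] at h1
  refine h1.congr_fun fun l => ?_
  rw [hc hf0, hc hg0, map_mul, mul_mul_mul_comm, Complex.mul_conj', norm_expChar]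
  simp

/-- The coefficients satisfy a Bessel inequality on short intervals. A translate of `E` carries most
of the energy of `h`; there Parseval's identity holds, and the remainder has a smaller energy. So any
bound on a finite part of the sum improves itself, and in the limit does not depend on that part. -/
theorem IsSpectrum.exists_bessel (hE : MeasurableSet E) (hvol : volume E = 1)
    (hS : IsSpectrum E Λ) :
    ∃ δ > 0, ∀ (s : ℝ) (h : ℝ → ℂ), MemL2Ball h s δ → ∀ F : Finset Λ,
      ∑ l ∈ F, ‖coeff l h‖ ^ 2 ≤ 4 * energy h := by
  -- leaving out a quarter of the energy improves a bound `C` to `2 + C / 2`, whose fixed point is `4`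
  obtain ⟨δ, hδ, H⟩ := exists_translate_energy_le hE (d := 0) (by simp [hvol])
    (show (0 : ℝ) < 1 / 4 by norm_num)
  refine ⟨δ, hδ, fun s h hh F => ?_⟩
  set C : ℝ := F.card * (2 * δ)
  have key : ∀ n : ℕ, ∀ h, MemL2Ball h s δ →
      ∑ l ∈ F, ‖coeff l h‖ ^ 2 ≤ (4 + C / 2 ^ n) * energy h := by
    intro n
    induction n with
    | zero =>
      intro h hh
      calc ∑ l ∈ F, ‖coeff l h‖ ^ 2 ≤ ∑ l ∈ F, 2 * δ * energy h :=
            Finset.sum_le_sum fun l _ => hh.norm_coeff_sq_le hδ l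
        _ = C * energy h := by rw [Finset.sum_const, nsmul_eq_mul]; ring
        _ ≤ _ := by
          have := energy_nonneg h
          rw [pow_zero, div_one]; nlinarith
    | succ n ih =>
      intro h hh
      by_cases h0 : energy h = 0
      · simpa [h0] using ih h hh
      obtain ⟨a, ha, -⟩ := H s h h hh (by simpa using hh) h0 h0
      have hU : MeasurableSet {y : ℝ | y - a ∈ E} := measurable_sub_const a hE
      set U := {y : ℝ | y - a ∈ E}
      have hi := hh.indicator hU
      have hi' := hh.indicator hU.compl
      have hP := hS.hasSum_translate hvol a hi.memLp hi.memLp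
        (fun y hy => indicator_of_notMem (show y ∉ U from hy) h)
        (fun y hy => indicator_of_notMem (show y ∉ U from hy) h)
      have e1 : ∫ x, U.indicator h x * conj (U.indicator h x) =
          ((energy (U.indicator h) : ℝ) : ℂ) := by
        rw [energy, ← integral_complex_ofReal]
        refine integral_congr_ae (Filter.Eventually.of_forall fun x => ?_)
        simp only [Complex.mul_conj']
        push_cast; rfl
      have hP' : HasSum (fun l : Λ => ‖coeff l (U.indicator h)‖ ^ 2) (energy (U.indicator h)) := by
        rw [e1] at hP
        refine Complex.hasSum_ofReal.1 (hP.congr_fun fun l => ?_)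
        rw [Complex.mul_conj']; push_cast; rfl
      have h1 : ∑ l ∈ F, ‖coeff l (U.indicator h)‖ ^ 2 ≤ energy h :=
        (sum_le_hasSum F (fun _ _ => by positivity) hP').trans (energy_indicator_le hU hh.memLp)
      have h2 := ih _ hi'
      have h3 : ∀ l : Λ, ‖coeff l h‖ ^ 2 ≤ 2 * ‖coeff l (U.indicator h)‖ ^ 2 +
          2 * ‖coeff l (Uᶜ.indicator h)‖ ^ 2 := by
        intro l
        have e2 : coeff l h = coeff l (U.indicator h) + coeff l (Uᶜ.indicator h) := by
          rw [← coeff_add hi.integrable hi'.integrable, indicator_self_add_compl]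
        rw [e2]
        have := norm_add_le (coeff l (U.indicator h)) (coeff l (Uᶜ.indicator h))
        nlinarith [norm_nonneg (coeff l (U.indicator h) + coeff l (Uᶜ.indicator h)),
          sq_nonneg (‖coeff l (U.indicator h)‖ - ‖coeff l (Uᶜ.indicator h)‖)]
      have h4 : 0 ≤ 4 + C / 2 ^ n := by positivity
      calc ∑ l ∈ F, ‖coeff l h‖ ^ 2
          ≤ 2 * ∑ l ∈ F, ‖coeff l (U.indicator h)‖ ^ 2 +
            2 * ∑ l ∈ F, ‖coeff l (Uᶜ.indicator h)‖ ^ 2 := by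
            rw [Finset.mul_sum, Finset.mul_sum, ← Finset.sum_add_distrib]
            exact Finset.sum_le_sum fun l _ => h3 l
        _ ≤ 2 * energy h + 2 * ((4 + C / 2 ^ n) * (1 / 4 * energy h)) := by
            have := mul_le_mul_of_nonneg_left ha h4
            linarith
        _ = (4 + C / 2 ^ (n + 1)) * energy h := by rw [pow_succ]; field_simp; ring
  have hlim : Filter.Tendsto (fun n : ℕ => (4 + C / 2 ^ n) * energy h) Filter.atTop
      (nhds ((4 + 0) * energy h)) :=
    ((tendsto_const_nhds.div_atTop (tendsto_pow_atTop_atTop_of_one_lt one_lt_two)).const_add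
      4).mul_const _
  rw [add_zero] at hlim
  exact ge_of_tendsto' hlim fun n => key n h hh

end Spectrum

/-! ### Parseval's identity on intervals of length less than one -/

/-- Parseval's identity holds for `h` and `k`, with the frequencies in `Λ`. -/
def IsParsevalPair (Λ : Set ℝ) (h k : ℝ → ℂ) : Prop :=
  HasSum (fun l : Λ => coeff l h * conj (coeff l k)) (∫ x, h x * conj (k x))

theorem IsParsevalPair.symm {Λ : Set ℝ} {h k : ℝ → ℂ} (H : IsParsevalPair Λ h k) :
    IsParsevalPair Λ k h := by
  have h1 := H.map (starRingEnd ℂ) Complex.continuous_conj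
  rw [← integral_conj] at h1
  have h2 : ∫ x, k x * conj (h x) = ∫ x, conj (h x * conj (k x)) := by simp [mul_comm]
  rw [IsParsevalPair, h2]
  exact h1.congr_fun fun l => by simp [mul_comm]

theorem IsParsevalPair.add_left {Λ : Set ℝ} {h h' k : ℝ → ℂ} (hh : MemLp h 2 volume)
    (hi : Integrable h) (hh' : MemLp h' 2 volume) (hi' : Integrable h') (hk : MemLp k 2 volume)
    (H : IsParsevalPair Λ h k) (H' : IsParsevalPair Λ h' k) : IsParsevalPair Λ (h + h') k := by
  have h1 := HasSum.add H H'
  rw [← integral_add (integrable_mul_conj hh hk) (integrable_mul_conj hh' hk)] at h1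
  simp only [IsParsevalPair, Pi.add_apply, add_mul]
  refine h1.congr_fun fun l => ?_
  rw [coeff_add hi hi', add_mul]

section Spectrum

variable {E Λ : Set ℝ}

/-- If `E` and `E - d` overlap, Parseval's identity holds for functions supported close to `s` and
`s + d`. Its defect vanishes for functions supported in one translate of `E`, and some translate of
`E` carries most of the energy of both functions; so every bound on the defect can be halved. -/
theorem IsSpectrum.exists_isParsevalPair (hE : MeasurableSet E) (hvol : volume E = 1)
    (hS : IsSpectrum E Λ) {d : ℝ} (hd : volume (E ∩ (fun y => y + d) ⁻¹' E) ≠ 0) :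
    ∃ δ > 0, ∀ (s : ℝ) (h k : ℝ → ℂ), MemL2Ball h s δ → MemL2Ball k (s + d) δ →
      IsParsevalPair Λ h k := by
  -- leaving out `1 / 16` of the energy costs `1 / 4` of the norm, for each of the two functions
  obtain ⟨δ₁, hδ₁, H⟩ := exists_translate_energy_le hE hd (show (0 : ℝ) < 1 / 16 by norm_num)
  obtain ⟨δ₂, hδ₂, B⟩ := hS.exists_bessel hE hvol
  refine ⟨min δ₁ δ₂, lt_min hδ₁ hδ₂, fun s h k hh hk => ?_⟩
  set δ := min δ₁ δ₂
  have hs₁ : ∀ s : ℝ, Metric.closedBall s δ ⊆ Metric.closedBall s δ₁ := fun s =>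
    Metric.closedBall_subset_closedBall (min_le_left _ _)
  have hs₂ : ∀ s : ℝ, Metric.closedBall s δ ⊆ Metric.closedBall s δ₂ := fun s =>
    Metric.closedBall_subset_closedBall (min_le_right _ _)
  have hpart : ∀ {h k : ℝ → ℂ}, MemL2Ball h s δ → MemL2Ball k (s + d) δ → ∀ F : Finset Λ,
      ∑ l ∈ F, ‖coeff l h * conj (coeff l k)‖ ≤ 4 * (√(energy h) * √(energy k)) := by
    intro h k hh hk F
    simp only [norm_mul, RCLike.norm_conj]
    calc ∑ l ∈ F, ‖coeff l h‖ * ‖coeff l k‖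
        ≤ √(∑ l ∈ F, ‖coeff l h‖ ^ 2) * √(∑ l ∈ F, ‖coeff l k‖ ^ 2) :=
          Real.sum_mul_le_sqrt_mul_sqrt F _ _
      _ ≤ √(2 ^ 2 * energy h) * √(2 ^ 2 * energy k) := by
          gcongr
          · exact (B s h (hh.mono (hs₂ _)) F).trans (by norm_num)
          · exact (B _ k (hk.mono (hs₂ _)) F).trans (by norm_num)
      _ = 4 * (√(energy h) * √(energy k)) := by
          rw [Real.sqrt_mul (by positivity), Real.sqrt_mul (by positivity),
            Real.sqrt_sq (by norm_num)]
          ring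
  have hsumm : ∀ {h k : ℝ → ℂ}, MemL2Ball h s δ → MemL2Ball k (s + d) δ →
      Summable fun l : Λ => ‖coeff l h * conj (coeff l k)‖ := fun hh hk =>
    summable_of_sum_le (fun _ => norm_nonneg _) (hpart hh hk)
  -- the defect in Parseval's identity
  let D : (ℝ → ℂ) → (ℝ → ℂ) → ℂ := fun h k =>
    (∑' l : Λ, coeff l h * conj (coeff l k)) - ∫ x, h x * conj (k x)
  have hD : ∀ {h k : ℝ → ℂ}, MemL2Ball h s δ → MemL2Ball k (s + d) δ →
      ‖D h k‖ ≤ 5 * (√(energy h) * √(energy k)) := by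
    intro h k hh hk
    have h1 : ‖∑' l : Λ, coeff l h * conj (coeff l k)‖ ≤ 4 * (√(energy h) * √(energy k)) :=
      (norm_tsum_le_tsum_norm (hsumm hh hk)).trans ((hsumm hh hk).tsum_le_of_sum_le (hpart hh hk))
    have h2 := norm_integral_mul_conj_le hh.memLp hk.memLp
    exact (norm_sub_le _ _).trans (by linarith)
  have hDl : ∀ {h h' k : ℝ → ℂ}, MemL2Ball h s δ → MemL2Ball h' s δ → MemL2Ball k (s + d) δ →
      D (h + h') k = D h k + D h' k := by
    intro h h' k hh hh' hk
    simp only [D, coeff_add hh.integrable hh'.integrable, add_mul, Pi.add_apply]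
    rw [(hsumm hh hk).of_norm.tsum_add (hsumm hh' hk).of_norm,
      integral_add (integrable_mul_conj hh.memLp hk.memLp)
        (integrable_mul_conj hh'.memLp hk.memLp)]
    ring
  have hDr : ∀ {h k k' : ℝ → ℂ}, MemL2Ball h s δ → MemL2Ball k (s + d) δ →
      MemL2Ball k' (s + d) δ → D h (k + k') = D h k + D h k' := by
    intro h k k' hh hk hk'
    simp only [D, coeff_add hk.integrable hk'.integrable, map_add, mul_add, Pi.add_apply]
    rw [(hsumm hh hk).of_norm.tsum_add (hsumm hh hk').of_norm,
      integral_add (integrable_mul_conj hh.memLp hk.memLp)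
        (integrable_mul_conj hh.memLp hk'.memLp)]
    ring
  have key : ∀ n : ℕ, ∀ h k, MemL2Ball h s δ → MemL2Ball k (s + d) δ →
      ‖D h k‖ ≤ 5 / 2 ^ n * (√(energy h) * √(energy k)) := by
    intro n
    induction n with
    | zero => intro h k hh hk; simpa using hD hh hk
    | succ n ih =>
      intro h k hh hk
      by_cases h0 : energy h = 0
      · simpa [h0] using hD hh hk
      by_cases k0 : energy k = 0
      · simpa [k0] using hD hh hk
      obtain ⟨a, ha, ha'⟩ := H s h k (hh.mono (hs₁ _)) (hk.mono (hs₁ _)) h0 k0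
      have hU : MeasurableSet {y : ℝ | y - a ∈ E} := measurable_sub_const a hE
      set U := {y : ℝ | y - a ∈ E}
      have hi := hh.indicator hU
      have hi' := hh.indicator hU.compl
      have ki := hk.indicator hU
      have ki' := hk.indicator hU.compl
      have hz : D (U.indicator h) (U.indicator k) = 0 :=
        sub_eq_zero.2 (hS.hasSum_translate hvol a hi.memLp ki.memLp
          (fun y hy => indicator_of_notMem (show y ∉ U from hy) h)
          (fun y hy => indicator_of_notMem (show y ∉ U from hy) k)).tsum_eq
      have e : D h k = D (U.indicator h) (Uᶜ.indicator k) + D (Uᶜ.indicator h) k := by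
        conv_lhs => rw [← indicator_self_add_compl U h, hDl hi hi' hk]
        conv_lhs => enter [1]; rw [← indicator_self_add_compl U k, hDr hi ki ki', hz, zero_add]
      have q : ∀ {x y : ℝ}, 0 ≤ y → x ≤ 1 / 16 * y → √x ≤ 1 / 4 * √y := by
        intro x y hy hxy
        calc √x ≤ √((1 / 4) ^ 2 * y) := Real.sqrt_le_sqrt (hxy.trans (by norm_num))
          _ = 1 / 4 * √y := by rw [Real.sqrt_mul (by positivity), Real.sqrt_sq (by norm_num)]
      have q1 := q (energy_nonneg h) ha
      have q2 := q (energy_nonneg k) ha'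
      have q3 : √(energy (U.indicator h)) ≤ √(energy h) :=
        Real.sqrt_le_sqrt (energy_indicator_le hU hh.memLp)
      calc ‖D h k‖ ≤ ‖D (U.indicator h) (Uᶜ.indicator k)‖ + ‖D (Uᶜ.indicator h) k‖ := by
            rw [e]; exact norm_add_le _ _
        _ ≤ 5 / 2 ^ n * (√(energy (U.indicator h)) * √(energy (Uᶜ.indicator k))) +
            5 / 2 ^ n * (√(energy (Uᶜ.indicator h)) * √(energy k)) :=
            add_le_add (ih _ _ hi ki') (ih _ _ hi' hk)
        _ ≤ 5 / 2 ^ n * (√(energy h) * (1 / 4 * √(energy k))) +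
            5 / 2 ^ n * (1 / 4 * √(energy h) * √(energy k)) := by gcongr
        _ = 5 / 2 ^ (n + 1) * (√(energy h) * √(energy k)) := by rw [pow_succ]; field_simp; ring
  have hlim : Filter.Tendsto (fun n : ℕ => 5 / (2 : ℝ) ^ n * (√(energy h) * √(energy k)))
      Filter.atTop (nhds (0 * (√(energy h) * √(energy k)))) :=
    (tendsto_const_nhds.div_atTop (tendsto_pow_atTop_atTop_of_one_lt one_lt_two)).mul_const _
  rw [zero_mul] at hlim
  have h0 : D h k = 0 := norm_le_zero_iff.1 (ge_of_tendsto' hlim fun n => key n h k hh hk)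
  have h1 := (hsumm hh hk).of_norm.hasSum
  rwa [sub_eq_zero.1 h0] at h1

theorem measure_overlap_ne_zero {L d : ℝ} (hL : L < 3 / 2) (hE : MeasurableSet E)
    (hEL : E ⊆ Ioc 0 L) (hvol : volume E = 1) (hd : |d| < 1) :
    volume (E ∩ (fun y => y + d) ⁻¹' E) ≠ 0 := by
  intro h
  rcases le_total 0 d with h0 | h0
  · have := one_le_of_measure_overlap_eq_zero hL hE hEL hvol h0 h
    linarith [le_abs_self d]
  · have := one_le_of_measure_overlap_eq_zero hL hE hEL hvol (x := -d) (by linarith) (by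
      rw [← h, ← measure_preimage_add_right volume d]
      congr 1
      ext x
      simp [and_comm])
    linarith [neg_le_abs d]

/-- The neighbourhoods in `IsSpectrum.exists_isParsevalPair` may be chosen uniformly for functions
supported at distance at most `r < 1`, by compactness. -/
theorem IsSpectrum.exists_isParsevalPair_uniform {L r : ℝ} (hL : L < 3 / 2) (hE : MeasurableSet E)
    (hEL : E ⊆ Ioc 0 L) (hvol : volume E = 1) (hS : IsSpectrum E Λ) (hr : r < 1) :
    ∃ δ > 0, ∀ (s t : ℝ) (h k : ℝ → ℂ), t - s ∈ Icc (-r) r → MemL2Ball h s δ → MemL2Ball k t δ →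
      IsParsevalPair Λ h k := by
  refine (isCompact_Icc (a := -r) (b := r)).induction_on
    (p := fun K => ∃ δ > 0, ∀ (s t : ℝ) (h k : ℝ → ℂ), t - s ∈ K → MemL2Ball h s δ →
      MemL2Ball k t δ → IsParsevalPair Λ h k) ?_ ?_ ?_ ?_
  · exact ⟨1, one_pos, fun _ _ _ _ h => absurd h (notMem_empty _)⟩
  · rintro K K' hKK' ⟨δ, hδ, H⟩
    exact ⟨δ, hδ, fun s t h k hst => H s t h k (hKK' hst)⟩
  · rintro K K' ⟨δ, hδ, H⟩ ⟨δ', hδ', H'⟩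
    refine ⟨min δ δ', lt_min hδ hδ', fun s t h k hst hh hk => ?_⟩
    rcases hst with hst | hst
    · exact H s t h k hst (hh.mono (Metric.closedBall_subset_closedBall (min_le_left _ _)))
        (hk.mono (Metric.closedBall_subset_closedBall (min_le_left _ _)))
    · exact H' s t h k hst (hh.mono (Metric.closedBall_subset_closedBall (min_le_right _ _)))
        (hk.mono (Metric.closedBall_subset_closedBall (min_le_right _ _)))
  · intro d hd
    obtain ⟨δ, hδ, H⟩ := hS.exists_isParsevalPair hE hvol
      (measure_overlap_ne_zero hL hE hEL hvol ((abs_le.2 hd).trans_lt hr))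
    refine ⟨Metric.closedBall d (δ / 2), mem_nhdsWithin_of_mem_nhds
      (Metric.closedBall_mem_nhds d (by positivity)), δ / 2, by positivity,
      fun s t h k hst hh hk => H s h k
        (hh.mono (Metric.closedBall_subset_closedBall (by linarith)))
        (hk.mono (Metric.closedBall_subset_closedBall' ?_))⟩
    rw [Metric.mem_closedBall, Real.dist_eq] at hst
    rw [Real.dist_eq, show t - (s + d) = t - s - d by ring]
    linarith

theorem memL2Ball_indicator_Ioc (m : ℝ) {a b δ : ℝ} (hδ : b - a ≤ δ) :
    MemL2Ball ((Ioc a b).indicator (expChar m)) a δ := by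
  refine ⟨(memLp_indicator_iff_restrict measurableSet_Ioc).2
    (memLp_expChar measure_Ioc_lt_top.ne m), fun y hy => indicator_of_notMem (fun h => hy ?_) _⟩
  rw [Metric.mem_closedBall, Real.dist_eq, abs_le]
  constructor <;> linarith [h.1, h.2]

/-- Parseval's identity for an exponential cut off to an interval of length less than one, obtained
by cutting the interval into short pieces. -/
theorem IsSpectrum.isParsevalPair_Ioc {L r : ℝ} (hL : L < 3 / 2) (hE : MeasurableSet E)
    (hEL : E ⊆ Ioc 0 L) (hvol : volume E = 1) (hS : IsSpectrum E Λ) (hr0 : 0 < r) (hr : r < 1)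
    (m : ℝ) : IsParsevalPair Λ ((Ioc 0 r).indicator (expChar m))
      ((Ioc 0 r).indicator (expChar m)) := by
  obtain ⟨δ, hδ, H⟩ := hS.exists_isParsevalPair_uniform hL hE hEL hvol hr
  obtain ⟨n, hn⟩ := exists_nat_gt (r / δ)
  have hn0 : (0 : ℝ) < n := lt_trans (by positivity) hn
  set w := r / n with hw
  have hw0 : 0 < w := by positivity
  have hwδ : w ≤ δ := by
    rw [div_lt_iff₀ hδ] at hn
    rw [hw, div_le_iff₀ hn0]; linarith
  have hnw : n * w = r := by rw [hw]; field_simp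
  have hM : ∀ a b : ℝ, MemL2Ball ((Ioc a b).indicator (expChar m)) a (b - a) := fun a b =>
    memL2Ball_indicator_Ioc m le_rfl
  have hglue : ∀ k : ℝ → ℂ, MemLp k 2 volume → (∀ i < n, IsParsevalPair Λ
      ((Ioc (i * w) ((i + 1) * w)).indicator (expChar m)) k) →
      ∀ j ≤ n, IsParsevalPair Λ ((Ioc 0 (j * w)).indicator (expChar m)) k := by
    intro k hk hi j
    induction j with
    | zero => intro _; simp [IsParsevalPair, coeff, hasSum_zero]
    | succ j ih =>
      intro hj
      have e : (Ioc 0 (((j + 1 : ℕ) : ℝ) * w)).indicator (expChar m) =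
          (Ioc 0 (j * w)).indicator (expChar m) +
            (Ioc (j * w) ((j + 1) * w)).indicator (expChar m) := by
        have e1 := indicator_union_of_disjoint
          (Ioc_disjoint_Ioc_of_le (a := 0) (d := (j + 1) * w) (le_refl (j * w))) (expChar m)
        rw [Ioc_union_Ioc_eq_Ioc (by positivity) (by nlinarith)] at e1
        push_cast
        exact e1
      rw [e]
      exact (ih (by lia)).add_left (hM _ _).memLp (hM _ _).integrable (hM _ _).memLp
        (hM _ _).integrable hk (hi j (by lia))
  rw [← hnw]
  refine hglue _ (hM _ _).memLp (fun i hi => ?_) n le_rfl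
  refine (hglue _ (hM _ _).memLp (fun j hj => ?_) n le_rfl).symm
  have hp : ∀ i : ℕ, MemL2Ball ((Ioc (i * w) ((i + 1) * w)).indicator (expChar m)) (i * w) δ :=
    fun i => memL2Ball_indicator_Ioc m (by linarith)
  have hb : ∀ i < n, 0 ≤ i * w ∧ i * w ≤ r := fun i hi => by
    have h1 : (i : ℝ) ≤ n := by exact_mod_cast hi.le
    exact ⟨by positivity, by rw [← hnw]; gcongr⟩
  exact H _ _ _ _ ⟨by linarith [(hb i hi).1, (hb j hj).2], by linarith [(hb i hi).2, (hb j hj).1]⟩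
    (hp j) (hp i)

/-- The frequencies in a spectrum differ by integers: in Parseval's identity for `expChar m` on
`(0, r]` the coefficient at `m` alone exhausts the energy as `r → 1`. -/
theorem IsSpectrum.exists_int_sub {L : ℝ} (hL : L < 3 / 2) (hE : MeasurableSet E)
    (hEL : E ⊆ Ioc 0 L) (hvol : volume E = 1) (hS : IsSpectrum E Λ) {l m : ℝ} (hl : l ∈ Λ)
    (hm : m ∈ Λ) : ∃ n : ℤ, l - m = n := by
  by_cases hlm : l = m
  · exact ⟨0, by simp [hlm]⟩
  have hne : m - l ≠ 0 := sub_ne_zero.2 (Ne.symm hlm)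
  have key : ∀ r ∈ Ioo (0 : ℝ) 1,
      ‖(expChar (m - l) r - 1) / (2 * Real.pi * Complex.I * ((m - l : ℝ) : ℂ))‖ ^ 2 ≤
        r - r ^ 2 := by
    intro r hr
    have hP := hS.isParsevalPair_Ioc hL hE hEL hvol hr.1 hr.2 m
    have hc : ∀ q : ℝ, coeff q ((Ioc 0 r).indicator (expChar m)) =
        ∫ x in (0 : ℝ)..r, expChar (m - q) x := by
      intro q
      rw [intervalIntegral.integral_of_le hr.1.le, ← integral_indicator measurableSet_Ioc, coeff]
      refine integral_congr_ae (Filter.Eventually.of_forall fun x => ?_)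
      by_cases hx : x ∈ Ioc 0 r
      · simp only [indicator_of_mem hx, expChar_mul, sub_eq_add_neg]
      · simp [indicator_of_notMem hx]
    have hv : ∫ x, (Ioc 0 r).indicator (expChar m) x * conj ((Ioc 0 r).indicator (expChar m) x) =
        ((r : ℝ) : ℂ) := by
      have e : ∀ x, (Ioc 0 r).indicator (expChar m) x *
          conj ((Ioc 0 r).indicator (expChar m) x) = (Ioc 0 r).indicator (fun _ => (1 : ℂ)) x := by
        intro x
        by_cases hx : x ∈ Ioc 0 r
        · simp only [indicator_of_mem hx, conj_expChar, expChar_mul, add_neg_cancel, expChar_zero]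
        · simp [indicator_of_notMem hx]
      simp only [e]
      rw [integral_indicator measurableSet_Ioc]
      simp [Measure.real, hr.1.le]
    have hP' : HasSum (fun q : Λ => ‖coeff q ((Ioc 0 r).indicator (expChar m))‖ ^ 2) r := by
      rw [IsParsevalPair, hv] at hP
      refine Complex.hasSum_ofReal.1 (hP.congr_fun fun q => ?_)
      rw [Complex.mul_conj']; push_cast; rfl
    have h2 := sum_le_hasSum {⟨m, hm⟩, ⟨l, hl⟩} (fun _ _ => by positivity) hP'
    rw [Finset.sum_pair (by simpa using Ne.symm hlm)] at h2
    simp only [hc, sub_self, expChar_zero] at h2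
    rw [intervalIntegral_expChar hne] at h2
    have h3 : ‖∫ _ in (0 : ℝ)..r, (1 : ℂ)‖ ^ 2 = r ^ 2 := by simp
    rw [h3] at h2
    linarith
  have hcont : Continuous fun r : ℝ =>
      ‖(expChar (m - l) r - 1) / (2 * Real.pi * Complex.I * ((m - l : ℝ) : ℂ))‖ ^ 2 :=
    ((((continuous_expChar _).sub continuous_const).div_const _).norm).pow 2
  have hcl : closure (Ioo (0 : ℝ) 1) = Icc 0 1 := closure_Ioo zero_ne_one
  have h1 : (1 : ℝ) ∈ closure (Ioo (0 : ℝ) 1) := by rw [hcl]; simp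
  have h2 := le_on_closure key hcont.continuousOn (by fun_prop) h1
  have h3 : (expChar (m - l) 1 - 1) / (2 * Real.pi * Complex.I * ((m - l : ℝ) : ℂ)) = 0 := by
    rw [one_pow, sub_self] at h2
    exact norm_eq_zero.1 (pow_eq_zero_iff two_ne_zero |>.1 (le_antisymm h2 (by positivity)))
  have h4 : expChar (m - l) 1 = 1 := by
    rw [div_eq_zero_iff] at h3
    rcases h3 with h3 | h3
    · exact sub_eq_zero.1 h3
    · exact absurd h3 (mul_ne_zero Complex.two_pi_I_ne_zero (by exact_mod_cast hne))
  obtain ⟨n, hn⟩ := (expChar_eq_one_iff _ _).1 h4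
  exact ⟨-n, by push_cast; linarith⟩

end Spectrum

/-! ### Passing to almost equal sets -/

theorem IsTiling.congr_ae {E E' T : Set ℝ} (hT : T.Countable) (h : E =ᵐ[volume] E')
    (H : IsTiling E T) : IsTiling E' T := by
  have h1 : ∀ t : ℝ, ((fun x => x + t) '' E : Set ℝ) =ᵐ[volume] ((fun x => x + t) '' E' : Set ℝ) := by
    intro t
    rw [image_add_right_eq_preimage, image_add_right_eq_preimage]
    exact (measurePreserving_add_right volume (-t)).quasiMeasurePreserving.preimage_ae_eq h
  refine ⟨fun s hs t ht hst => (H.1 hs ht hst).congr (h1 s).symm (h1 t).symm, ?_⟩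
  rw [← H.2]
  have := hT.to_subtype
  rw [biUnion_eq_iUnion, biUnion_eq_iUnion]
  exact measure_congr (Filter.EventuallyEq.countable_iUnion fun t : T => h1 t).compl.symm

theorem isSpectrum_congr_ae {E E' Λ : Set ℝ} (h : E =ᵐ[volume] E') :
    IsSpectrum E Λ ↔ IsSpectrum E' Λ := by
  let P : Measure ℝ → Prop := fun μ => ∃ e : Λ → Lp ℂ 2 μ,
    (∀ l : Λ, e l =ᵐ[μ]
      fun x : ℝ => Complex.exp (2 * Real.pi * Complex.I * ((l : ℝ) : ℂ) * (x : ℂ))) ∧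
    Pairwise (fun l m : Λ => inner ℂ (e l) (e m) = 0) ∧
    (Submodule.span ℂ (range e)).topologicalClosure = ⊤
  change P (volume.restrict E) ↔ P (volume.restrict E')
  rw [Measure.restrict_congr_set h]

theorem countable_of_isDiscrete {T : Set ℝ} (hT : IsDiscrete T) : T.Countable := by
  have := hT.to_subtype
  exact countable_coe_iff.1
    ((TopologicalSpace.separableSpace_iff_countable (α := T)).1 inferInstance)

theorem isDiscrete_range_intCast : IsDiscrete (range ((↑) : ℤ → ℝ)) :=
  ⟨Int.isClosedEmbedding_coe_real.isEmbedding.toHomeomorph.symm.isEmbedding.discreteTopology⟩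

theorem theorem1 (L ε : ℝ) (hε : 0 < ε) (hL : L = 3 / 2 - ε) (E : Set ℝ)
    (hE : NullMeasurableSet E volume) (hEL : E ⊆ Set.Icc 0 L) (hvol : volume E = 1) :
    (∀ Λ : Set ℝ, IsDiscrete Λ → (0 : ℝ) ∈ Λ →
      (IsTiling E Λ → Λ = Set.range ((↑) : ℤ → ℝ)) ∧
      (IsSpectrum E Λ → Λ = Set.range ((↑) : ℤ → ℝ))) ∧
    (TilesByTranslations E ↔ IsSpectral E) := by
  -- a measurable representative of `E`, without the point `0` so that it folds onto `(0, 1]`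
  obtain ⟨E', hE'm, hE', hE'L⟩ : ∃ E', MeasurableSet E' ∧ E =ᵐ[volume] E' ∧ E' ⊆ Ioc 0 L := by
    obtain ⟨E₁, hE₁, hE₁m, hE₁E⟩ := hE.exists_measurable_subset_ae_eq
    refine ⟨E₁ \ {0}, hE₁m.diff (measurableSet_singleton 0), hE₁E.symm.trans
      (sdiff_null_ae_eq_self (measure_singleton 0)).symm, fun x hx => ?_⟩
    have := hEL (hE₁ hx.1)
    exact ⟨lt_of_le_of_ne this.1 fun h => hx.2 h.symm, this.2⟩
  have hvol' : volume E' = 1 := by rw [← measure_congr hE', hvol]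
  have hL' : L < 3 / 2 := by linarith
  have hspec : ∀ {Λ}, IsSpectrum E Λ → IsSpectrum E' Λ := (isSpectrum_congr_ae hE').1
  refine ⟨fun Λ hΛ h0 => ⟨fun hT => ?_, fun hS => ?_⟩, ?_, ?_⟩
  · exact (hT.congr_ae (countable_of_isDiscrete hΛ) hE').eq_range_intCast hL' hE'm hE'L hvol' h0
  · refine (hspec hS).eq_range_intCast hL' hE'm hE'L hvol' fun l hl => ?_
    obtain ⟨n, hn⟩ := (hspec hS).exists_int_sub hL' hE'm hE'L hvol' hl h0
    exact ⟨n, by rw [← hn, sub_zero]⟩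
  · rintro ⟨T, hTd, hT⟩
    have h1 := (hT.congr_ae (countable_of_isDiscrete hTd) hE').measure_overlap_one hL' hE'm hE'L
      hvol'
    exact ⟨_, isDiscrete_range_intCast, (isSpectrum_congr_ae hE').2
      (isSpectrum_intCast hL' hE'm hE'L hvol' h1)⟩
  · rintro ⟨Λ, -, hS⟩
    have h1 := (hspec hS).measure_overlap_one hL' hE'm hE'L hvol' fun l hl m hm =>
      (hspec hS).exists_int_sub hL' hE'm hE'L hvol' hl hm
    exact ⟨_, isDiscrete_range_intCast, (isTiling_intCast hL' hE'm hE'L hvol' h1).congr_ae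
      (countable_range _) hE'.symm⟩
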